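/- Let $p\ge 1$ and $q,m\ge 0$ be integers and $n=q+m$. Let $\theta\in\mathbb R^{q\times p}$, let $\Sigma\in\mathbb R^{p\times p}$ be symmetric positive definite, and let $f:\mathbb R\to\mathbb R$ be a measurable function, nonnegative on $[0,\infty)$, such that $$(z,u)\longmapsto|\Sigma|^{-n/2}f\big[\mathrm{tr}\{(z-\theta)\Sigma^{-1}(z-\theta)^{T}\}+\mathrm{tr}\{\Sigma^{-1}u^{T}u\}\big],\qquad z\in\mathbb R^{q\times p},\ u\in\mathbb R^{m\times p},$$ is a probability density; let the pair of random matrices $(Z,U)$ have this density, and let $E_{\theta,\Sigma}$ denote the corresponding expectation. (This is the canonical form of the model $Y=M+\mathcal E$, with $Y$ an $n\times p$ matrix, $\mathcal E$ elliptically symmetric noise and $\mathrm{rank}\,M=q<p$: if $Q=(Q_1\ Q_2)$ is an orthogonal $n\times n$ matrix with $Q_2^{T}M=0$, then $Z=Q_1^{T}Y$, $U=Q_2^{T}Y$ and $\theta=Q_1^{T}M$.) Put $F^*(t)=\frac12\int_t^\infty f(v)\,dv$ and let $K^*$ be the normalizing constant $$K^*=\int|\Sigma|^{-n/2}F^*\big[\mathrm{tr}\{(z-\theta)\Sigma^{-1}(z-\theta)^{T}\}+\mathrm{tr}\{\Sigma^{-1}u^{T}u\}\big]\,dz\,du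 ,$$ which does not depend on $(\theta,\Sigma)$ and is assumed to be finite. Let $S=U^{T}U$, let $S^{+}$ be its Moore–Penrose inverse, and write $p\vee m=\max\{p,m\}$ and $p\wedge m=\min\{p,m\}$. For an estimator $\hat\Sigma=\hat\Sigma(Z,U)$ of $\Sigma$ consider the data-based loss and the risk $$L_S(\hat\Sigma,\Sigma)=\mathrm{tr}\big(S^{+}\Sigma(\Sigma^{-1}\hat\Sigma-I_p)^2\big),\qquad R(\hat\Sigma,\Sigma)=E_{\theta,\Sigma}[L_S(\hat\Sigma,\Sigma)]\in[0,\infty].$$ Let $$a_o=\frac1{K^*(p\vee m)},\qquad \hat\Sigma_{a_o}=a_oS,\qquad \hat\Sigma_{a_o,G}=a_o\Big(S+\frac{t}{\mathrm{tr}(S^{+})}\,SS^{+}\Big).$$ **Theorem.** If $$0\le t\le\frac{2\,((p\wedge m)-1)}{(p\vee m)-(p\wedge m)+1},$$ then $R(\hat\Sigma_{a_o,G},\Sigma)\le R(\hat\Sigma_{a_o},\Sigma)$. Moreover the difference of the losses $L_S(\hat\Sigma_{a_o,G},\Sigma)-L_S(\hat\Sigma_{a_o},\Sigma)$ is integrable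 with expectation at most $0$ (also when both risks are infinite). Both statements hold whether $S$ is almost surely invertible ($p\le m$) or singular ($p>m$). -/

import Mathlib

open MeasureTheory Set
open scoped ENNReal

/-- `X` is a Moore-Penrose inverse of the real matrix `A`: the four Penrose equations. -/
structure IsMoorePenrose {p : ℕ} (A X : Matrix (Fin p) (Fin p) ℝ) : Prop where
  mul_mul_left : A * X * A = A
  mul_mul_right : X * A * X = X
  symm_left : (A * X).transpose = A * X
  symm_right : (X * A).transpose = X * A

theorem IsMoorePenrose.unique {p : ℕ} {A X Y : Matrix (Fin p) (Fin p) ℝ}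
    (hX : IsMoorePenrose A X) (hY : IsMoorePenrose A Y) : X = Y := by
  have h1 : A * X = A * Y := by
    calc A * X = (A * X).transpose := hX.symm_left.symm
      _ = ((A * Y) * (A * X)).transpose := by
          rw [← Matrix.mul_assoc, hY.mul_mul_left]
      _ = (A * X) * (A * Y) := by rw [Matrix.transpose_mul, hX.symm_left, hY.symm_left]
      _ = A * Y := by rw [← Matrix.mul_assoc, hX.mul_mul_left]
  have h2 : X * A = Y * A := by
    calc X * A = (X * A).transpose := hX.symm_right.symm
      _ = ((X * A) * (Y * A)).transpose := by
          rw [Matrix.mul_assoc X A (Y * A), ← Matrix.mul_assoc A Y A, hY.mul_mul_left]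
      _ = (Y * A) * (X * A) := by rw [Matrix.transpose_mul, hX.symm_right, hY.symm_right]
      _ = Y * A := by rw [Matrix.mul_assoc Y A (X * A), ← Matrix.mul_assoc A X A, hX.mul_mul_left]
  calc X = X * A * X := hX.mul_mul_right.symm
    _ = Y * (A * X) := by rw [h2, Matrix.mul_assoc]
    _ = Y * A * Y := by rw [h1, Matrix.mul_assoc]
    _ = Y := hY.mul_mul_right

/-- The Moore-Penrose inverse of a symmetric matrix is symmetric. -/
theorem IsMoorePenrose.transpose_eq {p : ℕ} {A X : Matrix (Fin p) (Fin p) ℝ}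
    (hX : IsMoorePenrose A X) (hA : A.transpose = A) : X.transpose = X := by
  have h1 : A * X.transpose = X * A := by
    rw [← hX.symm_right, Matrix.transpose_mul, hA]
  have h2 : X.transpose * A = A * X := by
    rw [← hX.symm_left, Matrix.transpose_mul, hA]
  refine IsMoorePenrose.unique (A := A) ⟨?_, ?_, ?_, ?_⟩ hX
  · have := congrArg Matrix.transpose hX.mul_mul_left
    simpa only [Matrix.transpose_mul, hA, Matrix.mul_assoc] using this
  · have := congrArg Matrix.transpose hX.mul_mul_right
    simpa only [Matrix.transpose_mul, hA, Matrix.mul_assoc] using this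
  · rw [h1, hX.symm_right]
  · rw [h2, hX.symm_left]

theorem IsMoorePenrose.exists_of_isHermitian {p : ℕ} {A : Matrix (Fin p) (Fin p) ℝ}
    (hA : A.IsHermitian) : ∃ X, IsMoorePenrose A X := by
  classical
  obtain ⟨V, d, hV, hAV⟩ : ∃ (V : Matrix (Fin p) (Fin p) ℝ) (d : Fin p → ℝ),
      V.transpose * V = 1 ∧ A = V * Matrix.diagonal d * V.transpose := by
    refine ⟨hA.eigenvectorUnitary, hA.eigenvalues, ?_, ?_⟩
    · have := Unitary.coe_star_mul_self hA.eigenvectorUnitary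
      simpa [Matrix.star_eq_conjTranspose] using this
    · have := hA.spectral_theorem
      rw [Unitary.conjStarAlgAut_apply] at this
      simpa [Matrix.star_eq_conjTranspose, Function.comp_def] using this
  have key : ∀ a b : Fin p → ℝ, (V * Matrix.diagonal a * V.transpose) *
      (V * Matrix.diagonal b * V.transpose) =
      V * Matrix.diagonal (fun i => a i * b i) * V.transpose := by
    intro a b
    calc _ = V * Matrix.diagonal a * (V.transpose * V) * Matrix.diagonal b * V.transpose := by
          simp only [Matrix.mul_assoc]
      _ = _ := by rw [hV, Matrix.mul_one, Matrix.mul_assoc V, Matrix.diagonal_mul_diagonal]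
  have keyT : ∀ a : Fin p → ℝ, (V * Matrix.diagonal a * V.transpose).transpose =
      V * Matrix.diagonal a * V.transpose := by
    intro a
    simp [Matrix.transpose_mul, Matrix.mul_assoc]
  refine ⟨V * Matrix.diagonal (fun i => (d i)⁻¹) * V.transpose, ?_, ?_, ?_, ?_⟩
  · rw [hAV, key, key]; congr; ext i; simp
  · rw [hAV, key, key]; congr; ext i
    by_cases h : d i = 0 <;> simp [h]
  · rw [hAV, key, keyT]
  · rw [hAV, key, keyT]

/-- Every real square matrix has a Moore-Penrose inverse. -/
theorem IsMoorePenrose.exists {p : ℕ} (A : Matrix (Fin p) (Fin p) ℝ) :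
    ∃ X, IsMoorePenrose A X := by
  have hH : (A.transpose * A).IsHermitian := by
    rw [Matrix.IsHermitian, Matrix.conjTranspose_eq_transpose_of_trivial, Matrix.transpose_mul,
      Matrix.transpose_transpose]
  obtain ⟨Y, hY⟩ := IsMoorePenrose.exists_of_isHermitian hH
  have hBT : (A.transpose * A).transpose = A.transpose * A := by
    rw [Matrix.transpose_mul, Matrix.transpose_transpose]
  have hYT : Y.transpose = Y := hY.transpose_eq hBT
  have h0 : A * (Y * (A.transpose * A)) = A := by
    have hz : (A * (Y * (A.transpose * A)) - A).transpose *
        (A * (Y * (A.transpose * A)) - A) = 0 := by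
      have h1 : A.transpose * (A * (Y * (A.transpose * A)) - A) = 0 := by
        rw [Matrix.mul_sub, ← Matrix.mul_assoc, ← Matrix.mul_assoc, hY.mul_mul_left, sub_self]
      have h2 : A * (Y * (A.transpose * A)) - A = A * (Y * (A.transpose * A) - 1) := by
        rw [Matrix.mul_sub, Matrix.mul_one]
      nth_rewrite 1 [h2]
      rw [Matrix.transpose_mul, Matrix.mul_assoc, h1, Matrix.mul_zero]
    have := Matrix.conjTranspose_mul_self_eq_zero.mp
      (by rwa [Matrix.conjTranspose_eq_transpose_of_trivial] :
        (A * (Y * (A.transpose * A)) - A).conjTranspose *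
          (A * (Y * (A.transpose * A)) - A) = 0)
    exact sub_eq_zero.mp this
  refine ⟨Y * A.transpose, ?_, ?_, ?_, ?_⟩
  · simpa only [Matrix.mul_assoc] using h0
  · have := congrArg (· * A.transpose) hY.mul_mul_right
    simpa only [Matrix.mul_assoc] using this
  · simp only [Matrix.transpose_mul, Matrix.transpose_transpose, hYT, Matrix.mul_assoc]
  · simpa only [Matrix.mul_assoc] using hY.symm_right

/-- The Moore-Penrose inverse `A⁺`. -/
noncomputable def pinv {p : ℕ} (A : Matrix (Fin p) (Fin p) ℝ) : Matrix (Fin p) (Fin p) ℝ :=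
  (IsMoorePenrose.exists A).choose

theorem pinv_spec {p : ℕ} (A : Matrix (Fin p) (Fin p) ℝ) : IsMoorePenrose A (pinv A) :=
  (IsMoorePenrose.exists A).choose_spec

open scoped MatrixOrder in
theorem exists_eq_transpose_mul_self {p : ℕ} {A : Matrix (Fin p) (Fin p) ℝ} (hA : A.PosSemidef) :
    ∃ B : Matrix (Fin p) (Fin p) ℝ, A = B.transpose * B := by
  obtain ⟨B, hB⟩ := CStarAlgebra.nonneg_iff_eq_star_mul_self.mp hA.nonneg
  exact ⟨B, by rw [hB, Matrix.star_eq_conjTranspose,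
    Matrix.conjTranspose_eq_transpose_of_trivial]⟩

/-- Observations `(z, u)` of the canonical model: `z` is `q × p` and `u` is `m × p`. The space
carries the Lebesgue measure `volume`. -/
abbrev Obs (q m p : ℕ) : Type := (Fin q → Fin p → ℝ) × (Fin m → Fin p → ℝ)

/-- `tr {(z - θ) Σ⁻¹ (z - θ)ᵀ} + tr {Σ⁻¹ uᵀ u}`. -/
noncomputable def ellipticArg {q m p : ℕ} (θ : Matrix (Fin q) (Fin p) ℝ)
    (Sig : Matrix (Fin p) (Fin p) ℝ) (x : Obs q m p) : ℝ :=
  ((Matrix.of x.1 - θ) * Sig⁻¹ * (Matrix.of x.1 - θ).transpose).trace +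
    (Sig⁻¹ * ((Matrix.of x.2).transpose * Matrix.of x.2)).trace

/-- `(z, u) ↦ |Σ|^(-n/2) h[tr {(z - θ) Σ⁻¹ (z - θ)ᵀ} + tr {Σ⁻¹ uᵀ u}]`, where `n = q + m`. -/
noncomputable def ellipticDensity {q m p : ℕ} (h : ℝ → ℝ≥0∞) (θ : Matrix (Fin q) (Fin p) ℝ)
    (Sig : Matrix (Fin p) (Fin p) ℝ) (x : Obs q m p) : ℝ≥0∞ :=
  ENNReal.ofReal (Sig.det ^ (-((q + m : ℕ) : ℝ) / 2)) * h (ellipticArg θ Sig x)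

/-- The total mass of the elliptical density with generator `h` does not depend on `(θ, Σ)`. -/
theorem lintegral_ellipticDensity_eq {q m p : ℕ} (h : ℝ → ℝ≥0∞) (θ : Matrix (Fin q) (Fin p) ℝ)
    {Sig : Matrix (Fin p) (Fin p) ℝ} (hSig : Sig.PosDef) :
    ∫⁻ x : Obs q m p, ellipticDensity h θ Sig x = ∫⁻ x : Obs q m p, ellipticDensity h 0 1 x := by
  obtain ⟨B, hB⟩ := exists_eq_transpose_mul_self hSig.posSemidef
  have hdet : Sig.det = B.det ^ 2 := by rw [hB, Matrix.det_mul, Matrix.det_transpose, sq]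
  have hBdet : B.det ≠ 0 := by
    intro h0
    have := hSig.det_pos
    rw [hdet, h0] at this
    norm_num at this
  have hBu : IsUnit B.det := hBdet.isUnit
  have hBtu : IsUnit B.transpose.det := by rwa [Matrix.det_transpose]
  have hinv : B * Sig⁻¹ * B.transpose = 1 := by
    rw [hB, Matrix.mul_inv_rev, ← Matrix.mul_assoc, Matrix.mul_nonsing_inv _ hBu, Matrix.one_mul,
      Matrix.nonsing_inv_mul _ hBtu]
  let L (k : ℕ) : (Fin k → Fin p → ℝ) →ₗ[ℝ] (Fin k → Fin p → ℝ) :=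
    LinearMap.pi (fun i => (Matrix.toLin' B.transpose).comp (LinearMap.proj i))
  have hL : ∀ (k : ℕ) (w : Fin k → Fin p → ℝ), Matrix.of (L k w) = Matrix.of w * B := by
    intro k w
    ext i j
    simp [L, Matrix.mul_apply, Matrix.mulVec, dotProduct, mul_comm]
  have hLdet : ∀ k, LinearMap.det (L k) = B.det ^ k := by
    intro k
    simp [L, LinearMap.det_pi, Matrix.det_transpose]
  let T : Obs q m p →ₗ[ℝ] Obs q m p := (L q).prodMap (L m)
  have hTdet : LinearMap.det T = B.det ^ (q + m) := by
    rw [LinearMap.det_prodMap, hLdet, hLdet, pow_add]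
  have hT0 : LinearMap.det T ≠ 0 := by rw [hTdet]; exact pow_ne_zero _ hBdet
  have harg : ∀ x : Obs q m p,
      ellipticArg θ Sig (T x + ((fun i j => θ i j), 0)) = ellipticArg 0 1 x := by
    intro x
    have e1 : Matrix.of (T x + ((fun i j => θ i j), 0) : Obs q m p).1 - θ = Matrix.of x.1 * B := by
      rw [← hL]
      ext i j
      simp [T]
    have e2 : Matrix.of (T x + ((fun i j => θ i j), 0) : Obs q m p).2 = Matrix.of x.2 * B := by
      rw [← hL]
      ext i j
      simp [T]
    unfold ellipticArg
    rw [e1, e2]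
    congr 1
    · have : Matrix.of x.1 * B * Sig⁻¹ * (Matrix.of x.1 * B).transpose =
          Matrix.of x.1 * (B * Sig⁻¹ * B.transpose) * (Matrix.of x.1).transpose := by
        simp only [Matrix.transpose_mul, Matrix.mul_assoc]
      rw [this, hinv]
      simp
    · have : Sig⁻¹ * ((Matrix.of x.2 * B).transpose * (Matrix.of x.2 * B)) =
          Sig⁻¹ * B.transpose * ((Matrix.of x.2).transpose * Matrix.of x.2 * B) := by
        simp only [Matrix.transpose_mul, Matrix.mul_assoc]
      rw [this, Matrix.trace_mul_comm]
      have : (Matrix.of x.2).transpose * Matrix.of x.2 * B * (Sig⁻¹ * B.transpose) =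
          (Matrix.of x.2).transpose * Matrix.of x.2 * (B * Sig⁻¹ * B.transpose) := by
        simp only [Matrix.mul_assoc]
      rw [this, hinv]
      simp
  have hpi : ∀ k : ℕ, (volume : Measure (Fin k → Fin p → ℝ)).IsAddHaarMeasure := by
    intro k
    have : (volume : Measure (Fin p → ℝ)).IsAddHaarMeasure := inferInstance
    exact Measure.pi.isAddHaarMeasure (fun _ : Fin k => (volume : Measure (Fin p → ℝ)))
  have hq := hpi q
  have hm := hpi m
  have hvol : (volume : Measure (Obs q m p)).IsAddHaarMeasure := by
    rw [Measure.volume_eq_prod]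
    infer_instance
  have hmap : ∫⁻ x : Obs q m p, h (ellipticArg 0 1 x) =
      ENNReal.ofReal |(LinearMap.det T)⁻¹| * ∫⁻ x : Obs q m p, h (ellipticArg θ Sig x) := by
    let e : Obs q m p ≃ᵐ Obs q m p :=
      (T.equivOfDetNeZero hT0).toContinuousLinearEquiv.toHomeomorph.toMeasurableEquiv
    have he : ∀ x, e x = T x := fun x => rfl
    calc ∫⁻ x : Obs q m p, h (ellipticArg 0 1 x)
        = ∫⁻ x : Obs q m p, h (ellipticArg θ Sig (e x + ((fun i j => θ i j), 0))) := by
          simp_rw [he, harg]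
      _ = ∫⁻ y, h (ellipticArg θ Sig (y + ((fun i j => θ i j), 0)))
            ∂((volume : Measure (Obs q m p)).map e) :=
          (lintegral_map_equiv (fun y => h (ellipticArg θ Sig (y + ((fun i j => θ i j), 0)))) e).symm
      _ = ENNReal.ofReal |(LinearMap.det T)⁻¹| *
            ∫⁻ y : Obs q m p, h (ellipticArg θ Sig (y + ((fun i j => θ i j), 0))) := by
          have : (volume : Measure (Obs q m p)).map e =
              ENNReal.ofReal |(LinearMap.det T)⁻¹| • (volume : Measure (Obs q m p)) :=
            Measure.map_linearMap_addHaar_eq_smul_addHaar _ hT0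
          rw [this, lintegral_smul_measure, smul_eq_mul]
      _ = _ := by
          rw [lintegral_add_right_eq_self (fun y : Obs q m p => h (ellipticArg θ Sig y))]
  have hconst : |(LinearMap.det T)⁻¹| = Sig.det ^ (-((q + m : ℕ) : ℝ) / 2) := by
    rw [hTdet, abs_inv, abs_pow, hdet, ← sq_abs, ← Real.rpow_natCast (|B.det|) 2,
      ← Real.rpow_mul (abs_nonneg _), ← Real.rpow_natCast, ← Real.rpow_neg (abs_nonneg _)]
    congr 1
    push_cast
    ring
  unfold ellipticDensity
  rw [lintegral_const_mul' _ _ ENNReal.ofReal_ne_top, ← hconst, ← hmap]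
  simp

/-- The joint distribution of `(Z, U)` with density generator `f`. -/
noncomputable def canonicalLaw {q : ℕ} (m : ℕ) {p : ℕ} (f : ℝ → ℝ)
    (θ : Matrix (Fin q) (Fin p) ℝ) (Sig : Matrix (Fin p) (Fin p) ℝ) : Measure (Obs q m p) :=
  (volume : Measure (Obs q m p)).withDensity
    (ellipticDensity (fun v => ENNReal.ofReal (f v)) θ Sig)

/-- `F*(t) = (1/2) ∫_t^∞ f(v) dv`, with values in `[0, ∞]`. -/
noncomputable def FStar (f : ℝ → ℝ) (t : ℝ) : ℝ≥0∞ :=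
  2⁻¹ * ∫⁻ v in Ioi t, ENNReal.ofReal (f v)

/-- The constant `K*` that normalizes the density
`(z, u) ↦ |Σ|^(-n/2) F*[tr {(z - θ) Σ⁻¹ (z - θ)ᵀ} + tr {Σ⁻¹ uᵀ u}]`. It does not depend on
`(θ, Σ)` (see `lintegral_ellipticDensity_eq`), so it is defined with `θ = 0` and `Σ = I`. -/
noncomputable def kStar (q m p : ℕ) (f : ℝ → ℝ) : ℝ≥0∞ :=
  ∫⁻ x : Obs q m p, ellipticDensity (FStar f) 0 1 x

/-- `S = uᵀ u`. -/
def gram {m p : ℕ} (u : Fin m → Fin p → ℝ) : Matrix (Fin p) (Fin p) ℝ :=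
  (Matrix.of u).transpose * Matrix.of u

/-- The data-based loss `tr (S⁺ Σ (Σ⁻¹ Σ̂ - I)²)`. -/
noncomputable def dataLoss {p : ℕ} (S Sig SigHat : Matrix (Fin p) (Fin p) ℝ) : ℝ :=
  (pinv S * Sig * (Sig⁻¹ * SigHat - 1) ^ 2).trace

/-- The risk of an estimator `δ = δ(z, u)` of `Σ`: the expected data-based loss, as an element
of `[0, ∞]`. -/
noncomputable def dataRisk {q m p : ℕ} (f : ℝ → ℝ) (θ : Matrix (Fin q) (Fin p) ℝ)
    (Sig : Matrix (Fin p) (Fin p) ℝ) (δ : Obs q m p → Matrix (Fin p) (Fin p) ℝ) : ℝ≥0∞ :=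
  ∫⁻ x, ENNReal.ofReal (dataLoss (gram x.2) Sig (δ x)) ∂(canonicalLaw m f θ Sig)

/-- `a_o = 1 / (K* (p ∨ m))`. -/
noncomputable def aOpt (q m p : ℕ) (f : ℝ → ℝ) : ℝ :=
  1 / ((kStar q m p f).toReal * ((max p m : ℕ) : ℝ))

/-- The estimator `a_o S`. -/
noncomputable def usualEst (q m p : ℕ) (f : ℝ → ℝ) (x : Obs q m p) :
    Matrix (Fin p) (Fin p) ℝ :=
  aOpt q m p f • gram x.2

/-- The estimator `a_o (S + (t / tr S⁺) S S⁺)`. -/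
noncomputable def konnoEst (q m p : ℕ) (f : ℝ → ℝ) (t : ℝ) (x : Obs q m p) :
    Matrix (Fin p) (Fin p) ℝ :=
  aOpt q m p f •
    (gram x.2 + (t / (pinv (gram x.2)).trace) • (gram x.2 * pinv (gram x.2)))

/-- The data-based loss of a symmetric estimate is nonnegative, so that `dataRisk` loses nothing
by taking values in `[0, ∞]`. -/
theorem dataLoss_nonneg {p : ℕ} {S Sig SigHat : Matrix (Fin p) (Fin p) ℝ} (hS : S.PosSemidef)
    (hSig : Sig.PosDef) (hH : SigHat.transpose = SigHat) : 0 ≤ dataLoss S Sig SigHat := by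
  have hST : S.transpose = S := by
    simpa [Matrix.IsHermitian] using hS.isHermitian
  have hSigT : Sig.transpose = Sig := by
    simpa [Matrix.IsHermitian] using hSig.isHermitian
  have hP := pinv_spec S
  have hPT : (pinv S).transpose = pinv S := hP.transpose_eq hST
  have hPpsd : (pinv S).PosSemidef := by
    have := hS.conjTranspose_mul_mul_same (pinv S)
    rwa [Matrix.conjTranspose_eq_transpose_of_trivial, hPT, hP.mul_mul_right] at this
  have hu : IsUnit Sig.det := hSig.det_pos.ne'.isUnit
  have hDT : (SigHat - Sig).conjTranspose = SigHat - Sig := by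
    rw [Matrix.conjTranspose_eq_transpose_of_trivial, Matrix.transpose_sub, hH, hSigT]
  have hQ : ((SigHat - Sig) * Sig⁻¹ * (SigHat - Sig)).PosSemidef := by
    have := hSig.inv.posSemidef.conjTranspose_mul_mul_same (SigHat - Sig)
    rwa [hDT] at this
  have e : Sig * (Sig⁻¹ * SigHat - 1) ^ 2 = (SigHat - Sig) * Sig⁻¹ * (SigHat - Sig) := by
    have e1 : Sig⁻¹ * SigHat - 1 = Sig⁻¹ * (SigHat - Sig) := by
      rw [Matrix.mul_sub, Matrix.nonsing_inv_mul _ hu]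
    calc Sig * (Sig⁻¹ * SigHat - 1) ^ 2
        = Sig * Sig⁻¹ * (SigHat - Sig) * Sig⁻¹ * (SigHat - Sig) := by
          rw [e1, sq]; simp only [Matrix.mul_assoc]
      _ = _ := by rw [Matrix.mul_nonsing_inv _ hu, Matrix.one_mul]
  rw [dataLoss, Matrix.mul_assoc, e]
  obtain ⟨B, hB⟩ := exists_eq_transpose_mul_self hPpsd
  rw [hB, Matrix.mul_assoc, Matrix.trace_mul_comm]
  have := (hQ.mul_mul_conjTranspose_same B).trace_nonneg
  rwa [Matrix.conjTranspose_eq_transpose_of_trivial] at this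

/-! ### Radial integration against a quadratic form, and reduction to one test generator. -/

section Homogeneous

open Module

variable {E : Type*} [NormedAddCommGroup E] [NormedSpace ℝ E] [FiniteDimensional ℝ E]

/-! Let X be u if p ≤ m and uᵀ otherwise, so that X has p ∨ m rows and p ∧ m columns and XᵀX is
almost everywhere invertible. With g = t / tr S⁺, the difference of the losses is a_o² G - 2 a_o t,
where G = tr(Σ⁻¹(2g SS⁺ + g² S⁺)) (`dataLoss_sub_dataLoss`). Since a_o = 1/(K*(p ∨ m)), everything
rests on the single bound E[G] ≤ 2t (p ∨ m) K*.

In terms of X, G is the pairing of L with the vector field H = X(2tR / tr R + t²R² / (tr R)²), where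
R = (XᵀX)⁻¹ and 2L is the X-gradient of the elliptic form Q. A Stein–Haff integration by parts moves
the derivative onto H and replaces f by F*, so the bound would follow from div H ≤ 2t (p ∨ m). This
is where the range of t is used: the divergence involves only traces of powers of R, controlled by
tr R² ≤ (tr R)² and tr R³ ≤ tr R² tr R (`sum_ridgeFieldDeriv_le`).

Two obstacles remain. First, f is only measurable. But G is homogeneous of degree 2, like Q, so in
dimension d both ∫ f(Q) G and ∫ F*(Q) are constants independent of f times the same radial integral
∫ v^(d/2) f(v) dv. The inequality therefore needs checking for one generator only, f(v) = 4(1-v)₊,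
whose F* = (1-v)₊² is C¹ and makes all integrands compactly supported (`lintegral_mul_le_of_test`).
Second, H is singular where XᵀX is. Replacing R by (XᵀX + ε)⁻¹ makes H smooth at the cost of an
error proportional to ε tr R, which vanishes as ε → 0
(`lintegral_four_mul_max_mul_ridgePairing_le`). -/

theorem exists_pos_mul_sq_norm_le {Q : E → ℝ} (hQc : Continuous Q)
    (hQh : ∀ (s : ℝ) (x : E), Q (s • x) = s ^ 2 * Q x) (hQp : ∀ x, x ≠ 0 → 0 < Q x) :
    ∃ c : ℝ, 0 < c ∧ ∀ x, c * ‖x‖ ^ 2 ≤ Q x := by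
  have hQ0 : Q 0 = 0 := by simpa using hQh 0 0
  rcases (Metric.sphere (0 : E) 1).eq_empty_or_nonempty with h | h
  · refine ⟨1, one_pos, fun x => ?_⟩
    by_cases hx : x = 0
    · simp [hx, hQ0]
    · have : ‖x‖⁻¹ • x ∈ Metric.sphere (0 : E) 1 := by
        simp [norm_smul, norm_ne_zero_iff.2 hx]
      simp [h] at this
  · obtain ⟨y, hy, hmin⟩ := (isCompact_sphere (0 : E) 1).exists_isMinOn h hQc.continuousOn
    have hy0 : y ≠ 0 := by rintro rfl; simp at hy
    refine ⟨Q y, hQp y hy0, fun x => ?_⟩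
    by_cases hx : x = 0
    · simp [hx, hQ0]
    · have hxn : ‖x‖ ≠ 0 := norm_ne_zero_iff.2 hx
      have hm : ‖x‖⁻¹ • x ∈ Metric.sphere (0 : E) 1 := by simp [norm_smul, hxn]
      have h1 : Q y ≤ Q (‖x‖⁻¹ • x) := hmin hm
      rw [hQh] at h1
      calc Q y * ‖x‖ ^ 2 ≤ (‖x‖⁻¹ ^ 2 * Q x) * ‖x‖ ^ 2 := by gcongr
        _ = Q x := by field_simp

theorem isBounded_setOf_le {Q : E → ℝ} (hQc : Continuous Q)
    (hQh : ∀ (s : ℝ) (x : E), Q (s • x) = s ^ 2 * Q x) (hQp : ∀ x, x ≠ 0 → 0 < Q x) (v : ℝ) :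
    Bornology.IsBounded {x | Q x ≤ v} := by
  obtain ⟨c, hc, h⟩ := exists_pos_mul_sq_norm_le hQc hQh hQp
  refine isBounded_iff_forall_norm_le.2 ⟨|v| / c + 1, fun x hx => ?_⟩
  have h1 : ‖x‖ ^ 2 ≤ |v| / c := by
    rw [le_div_iff₀ hc]
    linarith [h x, le_abs_self v, show Q x ≤ v from hx]
  nlinarith [norm_nonneg x, sq_nonneg (‖x‖ - 1)]

variable [MeasurableSpace E] [BorelSpace E] (μ : Measure E) [μ.IsAddHaarMeasure]

theorem lintegral_eq_mul_lintegral_comp_smul {s : ℝ} (hs : 0 < s) (g : E → ℝ≥0∞) :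
    ∫⁻ x, g x ∂μ = ENNReal.ofReal (s ^ finrank ℝ E) * ∫⁻ x, g (s • x) ∂μ := by
  have h := Measure.map_addHaar_smul μ hs.ne'
  have h2 : ∫⁻ x, g (s • x) ∂μ = ∫⁻ x, g x ∂(μ.map (fun x => s • x)) :=
    (lintegral_map_equiv g (Homeomorph.smulOfNeZero s hs.ne').toMeasurableEquiv).symm
  rw [h2, h, lintegral_smul_measure, smul_eq_mul, ← mul_assoc,
    ← ENNReal.ofReal_mul (by positivity), abs_of_pos (by positivity),
    mul_inv_cancel₀ (by positivity)]
  simp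

/-- Dilation by √v carries {Q < 1} onto {Q < v}. Lebesgue measure contributes `finrank ℝ E` powers
of √v and `G` contributes `k` more. -/
theorem setLIntegral_sublevel_eq {Q : E → ℝ}
    (hQh : ∀ (s : ℝ) (x : E), Q (s • x) = s ^ 2 * Q x) (hQc : Continuous Q) {k : ℕ} {G : E → ℝ≥0∞}
    (hG : ∀ (s : ℝ) (x : E), 0 < s → G (s • x) = ENNReal.ofReal (s ^ k) * G x)
    {v : ℝ} (hv : 0 < v) :
    ∫⁻ x in {x | Q x < v}, G x ∂μ =
      ENNReal.ofReal (v ^ (((finrank ℝ E + k : ℕ) : ℝ) / 2)) * ∫⁻ x in {x | Q x < 1}, G x ∂μ := by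
  have hm : ∀ v, MeasurableSet {x | Q x < v} := fun v => (isOpen_lt hQc continuous_const).measurableSet
  have hs : 0 < √v := Real.sqrt_pos.2 hv
  rw [← lintegral_indicator (hm v), lintegral_eq_mul_lintegral_comp_smul μ hs,
    ← lintegral_indicator (hm 1)]
  have : ∀ x, indicator {x | Q x < v} G (√v • x) =
      ENNReal.ofReal (√v ^ k) * indicator {x | Q x < 1} G x := by
    intro x
    have : (√v • x ∈ {x | Q x < v}) ↔ x ∈ {x | Q x < 1} := by
      simp only [mem_ofPred_eq, hQh, Real.sq_sqrt hv.le]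
      constructor
      · intro h; by_contra h1; nlinarith
      · intro h; nlinarith
    by_cases hx : x ∈ {x | Q x < 1}
    · rw [indicator_of_mem (this.2 hx), indicator_of_mem hx, hG _ _ hs]
    · rw [indicator_of_notMem (fun h => hx (this.1 h)), indicator_of_notMem hx, mul_zero]
  simp_rw [this]
  rw [lintegral_const_mul' _ _ ENNReal.ofReal_ne_top, ← mul_assoc,
    ← ENNReal.ofReal_mul (by positivity), ← pow_add]
  congr 2
  rw [Real.sqrt_eq_rpow, ← Real.rpow_natCast, ← Real.rpow_mul hv.le]
  congr 1
  ring

theorem setLIntegral_rpow_Ioo {r v : ℝ} (hr : 0 < r) (hv : 0 < v) :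
    ∫⁻ x in Ioo 0 v, ENNReal.ofReal (r * x ^ (r - 1)) = ENNReal.ofReal (v ^ r) := by
  rw [← ofReal_integral_eq_lintegral_ofReal]
  · rw [← integral_Ioc_eq_integral_Ioo, ← intervalIntegral.integral_of_le hv.le,
      intervalIntegral.integral_const_mul, integral_rpow (Or.inl (by linarith))]
    congr 1
    rw [sub_add_cancel, Real.zero_rpow hr.ne']
    field_simp
    simp
  · have := (intervalIntegral.intervalIntegrable_rpow' (a := 0) (b := v)
      (by linarith : -1 < r - 1)).const_mul r
    exact ((intervalIntegrable_iff_integrableOn_Ioc_of_le hv.le).1 this).mono_set Ioo_subset_Ioc_self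
  · filter_upwards [ae_restrict_mem measurableSet_Ioo] with x hx
    have := hx.1
    positivity

/-- The measure G·μ pushed forward by `Q` gives (-∞, v) a mass proportional to v^r with r = (d +
k)/2, hence has density proportional to r v^(r-1) on (0, ∞). -/
theorem lintegral_comp_mul_eq {Q : E → ℝ}
    (hQh : ∀ (s : ℝ) (x : E), Q (s • x) = s ^ 2 * Q x) (hQc : Continuous Q)
    (hQp : ∀ x, x ≠ 0 → 0 < Q x) {k : ℕ} (hk : 0 < k) {G : E → ℝ≥0∞} (hGm : Measurable G)
    (hG : ∀ (s : ℝ) (x : E), 0 < s → G (s • x) = ENNReal.ofReal (s ^ k) * G x)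
    (hfin : ∫⁻ x in {x | Q x < 1}, G x ∂μ ≠ ∞) {h : ℝ → ℝ≥0∞} (hh : Measurable h) :
    ∫⁻ x, h (Q x) * G x ∂μ = (∫⁻ x in {x | Q x < 1}, G x ∂μ) *
      ∫⁻ v in Ioi 0, ENNReal.ofReal ((((finrank ℝ E + k : ℕ) : ℝ) / 2) *
        v ^ ((((finrank ℝ E + k : ℕ) : ℝ) / 2) - 1)) * h v := by
  set r : ℝ := ((finrank ℝ E + k : ℕ) : ℝ) / 2 with hr
  have hr0 : 0 < r := by
    have : 0 < finrank ℝ E + k := by omega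
    have : (0 : ℝ) < ((finrank ℝ E + k : ℕ) : ℝ) := by exact_mod_cast this
    positivity
  set c := ∫⁻ x in {x | Q x < 1}, G x ∂μ with hc
  have hQ0 : ∀ x, 0 ≤ Q x := by
    intro x
    by_cases hx : x = 0
    · have : Q 0 = 0 := by simpa using hQh 0 0
      rw [hx, this]
    · exact (hQp x hx).le
  have hdm : Measurable fun v : ℝ => ENNReal.ofReal (r * v ^ (r - 1)) := by fun_prop
  have key : (μ.withDensity G).map Q =
      c • ((volume.restrict (Ioi (0 : ℝ))).withDensity fun v => ENNReal.ofReal (r * v ^ (r - 1))) := by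
    have hL : ∀ v : ℝ, (μ.withDensity G).map Q (Iio v) = ∫⁻ x in {x | Q x < v}, G x ∂μ := by
      intro v
      rw [Measure.map_apply hQc.measurable measurableSet_Iio,
        withDensity_apply _ (hQc.measurable measurableSet_Iio)]
      rfl
    have hL2 : ∀ v : ℝ, v ≤ 0 → (μ.withDensity G).map Q (Iio v) = 0 := by
      intro v hv
      have : {x | Q x < v} = ∅ := by
        ext x
        simp only [mem_ofPred_eq, mem_empty_iff_false, iff_false, not_lt]
        exact hv.trans (hQ0 x)
      rw [hL, this]; simp
    have hL3 : ∀ v : ℝ, 0 < v → (μ.withDensity G).map Q (Iio v) = ENNReal.ofReal (v ^ r) * c := by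
      intro v hv
      rw [hL, setLIntegral_sublevel_eq μ hQh hQc hG hv]
    -- Open half-lines form a generating π-system. Finiteness on them is exactly what `hfin`
    -- supplies, via scaling.
    refine Measure.ext_of_generateFrom_of_iUnion (range Iio) (fun n : ℕ => Iio (n : ℝ))
      ((BorelSpace.measurable_eq (α := ℝ)).trans (borel_eq_generateFrom_Iio ℝ)) isPiSystem_Iio ?_
      (fun n => ⟨_, rfl⟩) ?_ ?_
    · ext x
      simp only [mem_iUnion, mem_Iio, mem_univ, iff_true]
      exact exists_nat_gt x
    · intro n
      rcases le_or_gt (n : ℝ) 0 with hn | hn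
      · rw [hL2 _ hn]; simp
      · rw [hL3 _ hn]; exact ENNReal.mul_ne_top ENNReal.ofReal_ne_top hfin
    · rintro _ ⟨v, rfl⟩
      rw [Measure.smul_apply, withDensity_apply _ measurableSet_Iio, smul_eq_mul,
        Measure.restrict_restrict measurableSet_Iio]
      rcases le_or_gt v 0 with hv | hv
      · have : Iio v ∩ Ioi 0 = ∅ := by
          ext x; simp only [mem_inter_iff, mem_Iio, mem_Ioi, mem_empty_iff_false, iff_false]
          rintro ⟨h1, h2⟩; linarith
        rw [hL2 v hv, this]; simp
      · have : Iio v ∩ Ioi 0 = Ioo 0 v := by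
          ext x; simp [and_comm]
        rw [hL3 v hv, this, setLIntegral_rpow_Ioo hr0 hv, mul_comm]
  calc ∫⁻ x, h (Q x) * G x ∂μ = ∫⁻ x, h (Q x) ∂(μ.withDensity G) := by
        rw [lintegral_withDensity_eq_lintegral_mul _ hGm
          (show Measurable fun x => h (Q x) from hh.comp hQc.measurable)]
        simp [mul_comm]
    _ = ∫⁻ v, h v ∂((μ.withDensity G).map Q) := (lintegral_map hh hQc.measurable).symm
    _ = _ := by
        rw [key, lintegral_smul_measure, lintegral_withDensity_eq_lintegral_mul _ hdm hh]
        rfl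

/-- Tonelli on the region Q x < v: for fixed v the x-integral is the volume of a sublevel set, a
multiple of v^(d/2). -/
theorem lintegral_FStar_comp {Q : E → ℝ}
    (hQh : ∀ (s : ℝ) (x : E), Q (s • x) = s ^ 2 * Q x) (hQc : Continuous Q)
    (hQp : ∀ x, x ≠ 0 → 0 < Q x) {f : ℝ → ℝ} (hf : Measurable f) :
    ∫⁻ x, FStar f (Q x) ∂μ = 2⁻¹ * (μ {x | Q x < 1} *
      ∫⁻ v in Ioi 0, ENNReal.ofReal (v ^ ((finrank ℝ E : ℝ) / 2)) * ENNReal.ofReal (f v)) := by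
  have hQ0 : ∀ x, 0 ≤ Q x := by
    intro x
    by_cases hx : x = 0
    · have : Q 0 = 0 := by simpa using hQh 0 0
      rw [hx, this]
    · exact (hQp x hx).le
  have hvol : ∀ v, 0 < v → μ {x | Q x < v} =
      ENNReal.ofReal (v ^ ((finrank ℝ E : ℝ) / 2)) * μ {x | Q x < 1} := by
    intro v hv
    have := setLIntegral_sublevel_eq μ hQh hQc (k := 0) (G := fun _ => 1) (by simp) hv
    simpa using this
  have hset : MeasurableSet {y : E × ℝ | Q y.1 < y.2} :=
    measurableSet_lt (hQc.measurable.comp measurable_fst) measurable_snd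
  have hmeas : Measurable (Function.uncurry fun (x : E) (v : ℝ) =>
      indicator {v | Q x < v} (fun v => ENNReal.ofReal (f v)) v) := by
    have : (Function.uncurry fun (x : E) (v : ℝ) =>
      indicator {v | Q x < v} (fun v => ENNReal.ofReal (f v)) v) =
        indicator {y : E × ℝ | Q y.1 < y.2} (fun y => ENNReal.ofReal (f y.2)) := by
      ext ⟨x, v⟩; simp [indicator]
    rw [this]
    exact (hf.ennreal_ofReal.comp measurable_snd).indicator hset
  unfold FStar
  rw [lintegral_const_mul' _ _ (by simp)]
  congr 1
  calc ∫⁻ x, (∫⁻ v in Ioi (Q x), ENNReal.ofReal (f v)) ∂μ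
      = ∫⁻ x, (∫⁻ v, indicator {v | Q x < v} (fun v => ENNReal.ofReal (f v)) v) ∂μ := by
        refine lintegral_congr fun x => ?_
        exact (lintegral_indicator measurableSet_Ioi _).symm
    _ = ∫⁻ v, ∫⁻ x, indicator {v | Q x < v} (fun v => ENNReal.ofReal (f v)) v ∂μ :=
        lintegral_lintegral_swap hmeas.aemeasurable
    _ = ∫⁻ v, indicator (Ioi 0) (fun v => μ {x | Q x < 1} *
          (ENNReal.ofReal (v ^ ((finrank ℝ E : ℝ) / 2)) * ENNReal.ofReal (f v))) v := by
        refine lintegral_congr fun v => ?_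
        have hms : MeasurableSet {x | Q x < v} := (isOpen_lt hQc continuous_const).measurableSet
        have : ∀ x, indicator {v | Q x < v} (fun v => ENNReal.ofReal (f v)) v =
            indicator {x | Q x < v} (fun _ => ENNReal.ofReal (f v)) x := by
          intro x; simp [indicator]
        simp_rw [this]
        rw [lintegral_indicator hms, lintegral_const, Measure.restrict_apply_univ]
        by_cases hv : 0 < v
        · rw [indicator_of_mem (show v ∈ Ioi 0 from hv), hvol v hv]; ring
        · have : {x | Q x < v} = ∅ := by
            ext x
            simp only [mem_ofPred_eq, mem_empty_iff_false, iff_false, not_lt]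
            exact (not_lt.1 hv).trans (hQ0 x)
          rw [indicator_of_notMem (show v ∉ Ioi 0 from hv), this]; simp
    _ = _ := by
        rw [lintegral_indicator measurableSet_Ioi, lintegral_const_mul]
        exact (by fun_prop : Measurable fun v : ℝ =>
          ENNReal.ofReal (v ^ ((finrank ℝ E : ℝ) / 2))).mul hf.ennreal_ofReal

/-- Degree 2 is what matters: then r - 1 = d/2, so the radial integral of `f` is the same as in
`lintegral_FStar_comp` and can be eliminated. The ratio is cross-multiplied to remain in [0, ∞]. -/
theorem lintegral_ofReal_comp_mul_eq {Q : E → ℝ}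
    (hQh : ∀ (s : ℝ) (x : E), Q (s • x) = s ^ 2 * Q x) (hQc : Continuous Q)
    (hQp : ∀ x, x ≠ 0 → 0 < Q x) {G : E → ℝ≥0∞} (hGm : Measurable G)
    (hG : ∀ (s : ℝ) (x : E), 0 < s → G (s • x) = ENNReal.ofReal (s ^ 2) * G x)
    (hfin : ∫⁻ x in {x | Q x < 1}, G x ∂μ ≠ ∞) {f : ℝ → ℝ} (hf : Measurable f) :
    (∫⁻ x, ENNReal.ofReal (f (Q x)) * G x ∂μ) * μ {x | Q x < 1} =
      (∫⁻ x in {x | Q x < 1}, G x ∂μ) * ENNReal.ofReal (finrank ℝ E + 2) *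
        ∫⁻ x, FStar f (Q x) ∂μ := by
  rw [lintegral_comp_mul_eq μ hQh hQc hQp two_pos hGm hG hfin hf.ennreal_ofReal,
    lintegral_FStar_comp μ hQh hQc hQp hf]
  have e : (((finrank ℝ E + 2 : ℕ) : ℝ) / 2) - 1 = (finrank ℝ E : ℝ) / 2 := by push_cast; ring
  have e2 : ENNReal.ofReal (((finrank ℝ E + 2 : ℕ) : ℝ) / 2) =
      ENNReal.ofReal (finrank ℝ E + 2) * 2⁻¹ := by
    rw [ENNReal.ofReal_div_of_pos two_pos, div_eq_mul_inv]; push_cast; simp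
  rw [e]
  simp_rw [ENNReal.ofReal_mul (show (0 : ℝ) ≤ ((finrank ℝ E + 2 : ℕ) : ℝ) / 2 by positivity),
    mul_assoc]
  rw [lintegral_const_mul' _ _ ENNReal.ofReal_ne_top, e2]
  ring

theorem FStar_four_mul_max_one_sub {v : ℝ} :
    FStar (fun v => 4 * max (1 - v) 0) v = ENNReal.ofReal (max (1 - v) 0 ^ 2) := by
  have h1 : ∫⁻ x in Ioi v, ENNReal.ofReal (4 * max (1 - x) 0) =
      ENNReal.ofReal (2 * max (1 - v) 0 ^ 2) := by
    rcases le_or_gt 1 v with hv | hv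
    · rw [max_eq_right (by linarith)]
      rw [setLIntegral_congr_fun (g := fun _ => 0) measurableSet_Ioi]
      · simp
      · intro x hx
        have : v < x := hx
        simp only
        rw [max_eq_right (by linarith)]; simp
    · have hu : Ioi v = Ioc v 1 ∪ Ioi 1 := (Ioc_union_Ioi_eq_Ioi hv.le).symm
      rw [hu, lintegral_union measurableSet_Ioi (Ioc_disjoint_Ioi le_rfl)]
      have h2 : ∫⁻ x in Ioi (1 : ℝ), ENNReal.ofReal (4 * max (1 - x) 0) = 0 := by
        rw [setLIntegral_congr_fun (g := fun _ => 0) measurableSet_Ioi]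
        · simp
        · intro x hx
          have : 1 < x := hx
          simp only
          rw [max_eq_right (by linarith)]; simp
      rw [h2, add_zero, max_eq_left (by linarith), ← ofReal_integral_eq_lintegral_ofReal]
      · congr 1
        rw [← intervalIntegral.integral_of_le hv.le]
        have : ∀ x ∈ uIcc v 1, HasDerivAt (fun x : ℝ => -2 * (1 - x) ^ 2) (4 * max (1 - x) 0) x := by
          intro x hx
          rw [uIcc_of_le hv.le] at hx
          rw [max_eq_left (by linarith [hx.2])]
          have := (((hasDerivAt_id x).const_sub 1).pow 2).const_mul (-2)
          exact this.congr_deriv (by simp only [id_eq]; norm_num; ring)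
        rw [intervalIntegral.integral_eq_sub_of_hasDerivAt this]
        · ring
        · apply Continuous.intervalIntegrable; fun_prop
      · apply Continuous.integrableOn_Ioc; fun_prop
      · filter_upwards with x; positivity
  rw [FStar, h1, ENNReal.ofReal_mul (by norm_num)]
  rw [← mul_assoc]
  simp [ENNReal.inv_mul_cancel]

/-- By `lintegral_ofReal_comp_mul_eq` the best constant does not see the generator, so one test
generator decides for all `f`. -/
theorem lintegral_mul_le_of_test {Q : E → ℝ}
    (hQh : ∀ (s : ℝ) (x : E), Q (s • x) = s ^ 2 * Q x) (hQc : Continuous Q)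
    (hQp : ∀ x, x ≠ 0 → 0 < Q x) {G : E → ℝ≥0∞} (hGm : Measurable G)
    (hG : ∀ (s : ℝ) (x : E), 0 < s → G (s • x) = ENNReal.ofReal (s ^ 2) * G x) {M : ℝ}
    (hM : ∫⁻ x, ENNReal.ofReal (4 * max (1 - Q x) 0) * G x ∂μ ≤
      ENNReal.ofReal M * ∫⁻ x, ENNReal.ofReal (max (1 - Q x) 0 ^ 2) ∂μ)
    {f : ℝ → ℝ} (hf : Measurable f) :
    ∫⁻ x, ENNReal.ofReal (f (Q x)) * G x ∂μ ≤ ENNReal.ofReal M * ∫⁻ x, FStar f (Q x) ∂μ := by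
  have hQ00 : Q 0 = 0 := by simpa using hQh 0 0
  have hQ0 : ∀ x, 0 ≤ Q x := by
    intro x
    by_cases hx : x = 0
    · rw [hx, hQ00]
    · exact (hQp x hx).le
  have hbd : ∀ v, μ {x | Q x ≤ v} ≠ ∞ := fun v =>
    (isBounded_setOf_le hQc hQh hQp v).measure_lt_top.ne
  have hle : MeasurableSet {x | Q x ≤ 1} := (isClosed_le hQc continuous_const).measurableSet
  have hK : ∫⁻ x, ENNReal.ofReal (max (1 - Q x) 0 ^ 2) ∂μ ≠ ∞ := by
    refine ne_top_of_le_ne_top (hbd 1) ?_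
    calc ∫⁻ x, ENNReal.ofReal (max (1 - Q x) 0 ^ 2) ∂μ
        ≤ ∫⁻ x, indicator {x | Q x ≤ 1} 1 x ∂μ := by
          refine lintegral_mono fun x => ?_
          by_cases hx : Q x ≤ 1
          · rw [indicator_of_mem (show x ∈ {x | Q x ≤ 1} from hx), max_eq_left (by linarith)]
            simp only [Pi.one_apply, ENNReal.ofReal_le_one]
            nlinarith [hQ0 x]
          · rw [max_eq_right (by linarith)]; simp
      _ = μ {x | Q x ≤ 1} := by rw [lintegral_indicator_one hle]
  have hpos : ∀ v : ℝ, 0 < v → 0 < μ {x | Q x < v} := fun v hv =>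
    (isOpen_lt hQc continuous_const).measure_pos μ ⟨0, by simpa [hQ00] using hv⟩
  have hc0 : μ {x | Q x < 1} ≠ ∞ :=
    ne_top_of_le_ne_top (hbd 1) (measure_mono fun x (hx : Q x < 1) => hx.le)
  have hlt : ∀ v, MeasurableSet {x | Q x < v} := fun v =>
    (isOpen_lt hQc continuous_const).measurableSet
  have hK0 : ∫⁻ x, ENNReal.ofReal (max (1 - Q x) 0 ^ 2) ∂μ ≠ 0 := by
    intro h0
    rw [lintegral_eq_zero_iff (by fun_prop)] at h0
    have : μ {x | Q x < 1} = 0 := by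
      refine measure_mono_null (fun x (hx : Q x < 1) => ?_) (show μ _ = 0 from h0)
      have : 0 < max (1 - Q x) 0 ^ 2 := by
        rw [max_eq_left (by linarith)]; have : 0 < 1 - Q x := by linarith
        positivity
      exact (ENNReal.ofReal_pos.2 this).ne'
    exact (hpos 1 one_pos).ne' this
  have hfin : ∫⁻ x in {x | Q x < 1}, G x ∂μ ≠ ∞ := by
    -- Where Q < 1/2 the test weight 4(1-Q) is at least 1, so the tested inequality itself forces
    -- `G` to be integrable there; scaling extends this to {Q < 1}.
    have h1 : ∫⁻ x in {x | Q x < 1 / 2}, G x ∂μ ≠ ∞ := by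
      refine ne_top_of_le_ne_top (ENNReal.mul_ne_top ENNReal.ofReal_ne_top hK) (le_trans ?_ hM)
      rw [← lintegral_indicator (hlt _)]
      refine lintegral_mono fun x => ?_
      by_cases hx : Q x < 1 / 2
      · rw [indicator_of_mem (show x ∈ {x | Q x < 1 / 2} from hx), max_eq_left (by linarith)]
        refine le_mul_of_one_le_left' ?_
        rw [ENNReal.one_le_ofReal]; linarith
      · rw [indicator_of_notMem (show x ∉ {x | Q x < 1 / 2} from hx)]; exact zero_le
    rw [setLIntegral_sublevel_eq μ hQh hQc hG (by norm_num : (0 : ℝ) < 1 / 2)] at h1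
    intro h2
    rw [h2, ENNReal.mul_top] at h1
    · exact h1 rfl
    · have : (0 : ℝ) < (1 / 2) ^ (((finrank ℝ E + 2 : ℕ) : ℝ) / 2) := by positivity
      exact (ENNReal.ofReal_pos.2 this).ne'
  have hA := lintegral_ofReal_comp_mul_eq μ hQh hQc hQp hGm hG hfin hf
  have hB := lintegral_ofReal_comp_mul_eq μ hQh hQc hQp hGm hG hfin
    (f := fun v => 4 * max (1 - v) 0) (by fun_prop)
  simp_rw [FStar_four_mul_max_one_sub] at hB
  -- Cancelling ∫(1-Q)₊², which is positive and finite, leaves an inequality in which no generator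
  -- appears.
  have hC : (∫⁻ x in {x | Q x < 1}, G x ∂μ) * ENNReal.ofReal (finrank ℝ E + 2) ≤
      ENNReal.ofReal M * μ {x | Q x < 1} := by
    refine (ENNReal.mul_le_mul_iff_left hK0 hK).1 ?_
    rw [← hB]
    calc _ ≤ _ := mul_le_mul_left hM _
      _ = _ := by ring
  refine (ENNReal.mul_le_mul_iff_left (hpos 1 one_pos).ne' hc0).1 ?_
  rw [hA]
  calc _ ≤ _ := mul_le_mul_left hC _
    _ = _ := by ring

end Homogeneous

/-! ### Entrywise calculus of matrix curves. -/

section MatrixDerivative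

open Matrix Filter Topology

variable {α β γ : Type*}

/-- `F'` is the entrywise derivative at `0` of the matrix curve `F`. -/
def HasEntryDeriv (F : ℝ → Matrix α β ℝ) (F' : Matrix α β ℝ) : Prop :=
  ∀ i j, HasDerivAt (fun s => F s i j) (F' i j) 0

theorem HasEntryDeriv.mul [Fintype β] {F : ℝ → Matrix α β ℝ} {F' : Matrix α β ℝ}
    {G : ℝ → Matrix β γ ℝ} {G' : Matrix β γ ℝ} (hF : HasEntryDeriv F F')
    (hG : HasEntryDeriv G G') :
    HasEntryDeriv (fun s => F s * G s) (F' * G 0 + F 0 * G') := by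
  intro i j
  simp only [Matrix.add_apply, Matrix.mul_apply, ← Finset.sum_add_distrib]
  exact HasDerivAt.fun_sum fun k _ => (hF i k).mul (hG k j)

theorem HasEntryDeriv.transpose {F : ℝ → Matrix α β ℝ} {F' : Matrix α β ℝ}
    (hF : HasEntryDeriv F F') : HasEntryDeriv (fun s => (F s)ᵀ) F'ᵀ :=
  fun i j => hF j i

theorem HasEntryDeriv.add_const {F : ℝ → Matrix α β ℝ} {F' : Matrix α β ℝ}
    (hF : HasEntryDeriv F F') (C : Matrix α β ℝ) : HasEntryDeriv (fun s => F s + C) F' :=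
  fun i j => (hF i j).add_const (C i j)

theorem HasEntryDeriv.trace [Fintype β] {F : ℝ → Matrix β β ℝ} {F' : Matrix β β ℝ}
    (hF : HasEntryDeriv F F') : HasDerivAt (fun s => (F s).trace) F'.trace 0 :=
  HasDerivAt.fun_sum fun k _ => hF k k

theorem hasEntryDeriv_add_smul (X E : Matrix α β ℝ) : HasEntryDeriv (fun s => X + s • E) E := by
  intro i j
  have := ((hasDerivAt_id (0 : ℝ)).mul_const (E i j)).const_add (X i j)
  simpa using this

theorem HasEntryDeriv.tendsto {F : ℝ → Matrix α β ℝ} {F' : Matrix α β ℝ}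
    (hF : HasEntryDeriv F F') : Tendsto F (𝓝 0) (𝓝 (F 0)) :=
  tendsto_pi_nhds.2 fun i => tendsto_pi_nhds.2 fun j => (hF i j).continuousAt

theorem tendsto_nonsing_inv [Fintype β] [DecidableEq β] {ι : Type*} {l : Filter ι}
    {F : ι → Matrix β β ℝ} {A : Matrix β β ℝ} (hF : Tendsto F l (𝓝 A)) (hA : A.det ≠ 0) :
    Tendsto (fun s => (F s)⁻¹) l (𝓝 A⁻¹) := by
  refine (continuousAt_matrix_inv A ?_).tendsto.comp hF
  rw [Ring.inverse_eq_inv']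
  exact continuousAt_inv₀ hA

/-- The resolvent identity B⁻¹ - A⁻¹ = -B⁻¹(B - A)A⁻¹ turns the difference quotient of the inverse
into a product of convergent factors. -/
theorem HasEntryDeriv.nonsing_inv [Fintype β] [DecidableEq β] {F : ℝ → Matrix β β ℝ}
    {F' : Matrix β β ℝ} (hF : HasEntryDeriv F F') (hdet : ∀ s, (F s).det ≠ 0) :
    HasEntryDeriv (fun s => (F s)⁻¹) (-((F 0)⁻¹ * F' * (F 0)⁻¹)) := by
  have hu : ∀ s, IsUnit (F s).det := fun s => (hdet s).isUnit
  have hslope : Tendsto (fun s : ℝ => s⁻¹ • (F s - F 0)) (𝓝[≠] 0) (𝓝 F') := by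
    refine tendsto_pi_nhds.2 fun i => tendsto_pi_nhds.2 fun j => ?_
    simpa using hasDerivAt_iff_tendsto_slope_zero.1 (hF i j)
  have hinv : Tendsto (fun s => (F s)⁻¹) (𝓝[≠] 0) (𝓝 (F 0)⁻¹) :=
    (tendsto_nonsing_inv hF.tendsto (hdet 0)).mono_left nhdsWithin_le_nhds
  have hlim := ((hinv.mul hslope).mul_const (F 0)⁻¹).neg
  intro i j
  rw [hasDerivAt_iff_tendsto_slope_zero]
  refine ((tendsto_pi_nhds.1 (tendsto_pi_nhds.1 hlim i)) j).congr fun s => ?_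
  have : -((F s)⁻¹ * (s⁻¹ • (F s - F 0)) * (F 0)⁻¹) = s⁻¹ • ((F s)⁻¹ - (F 0)⁻¹) := by
    rw [Matrix.mul_smul, Matrix.smul_mul, Matrix.mul_sub, Matrix.sub_mul,
      Matrix.nonsing_inv_mul _ (hu s), Matrix.mul_assoc (F s)⁻¹, Matrix.mul_nonsing_inv _ (hu 0),
      Matrix.one_mul, Matrix.mul_one, ← smul_neg, neg_sub]
  rw [this]
  simp

end MatrixDerivative

/-! ### Traces of products of positive semidefinite matrices. -/

section TraceInequality

open Matrix

variable {β : Type*} [Fintype β] [DecidableEq β]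

omit [DecidableEq β] in
-- The three traces are squared Frobenius norms, of CDᵀ, C and D; submultiplicativity is
-- Cauchy–Schwarz in each entry of CDᵀ.
theorem trace_transpose_mul_self_mul_le {C D : Matrix β β ℝ} :
    ((Cᵀ * C) * (Dᵀ * D)).trace ≤ (Cᵀ * C).trace * (Dᵀ * D).trace := by
  have h1 : ∀ M : Matrix β β ℝ, (Mᵀ * M).trace = ∑ i, ∑ j, M i j ^ 2 := by
    intro M
    simp only [Matrix.trace, Matrix.diag, Matrix.mul_apply, Matrix.transpose_apply, sq]
    exact Finset.sum_comm
  have h2 : ((Cᵀ * C) * (Dᵀ * D)).trace = ((C * Dᵀ)ᵀ * (C * Dᵀ)).trace := by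
    rw [Matrix.transpose_mul, Matrix.transpose_transpose, Matrix.mul_assoc, Matrix.trace_mul_comm,
      Matrix.trace_mul_comm _ (C * Dᵀ)]
    simp only [Matrix.mul_assoc]
  rw [h2, h1, h1, h1, Finset.sum_mul_sum]
  refine Finset.sum_le_sum fun i _ => Finset.sum_le_sum fun j _ => ?_
  simp only [Matrix.mul_apply, Matrix.transpose_apply]
  exact Finset.sum_mul_sq_le_sq_mul_sq _ _ _

open scoped MatrixOrder in
theorem Matrix.PosSemidef.exists_transpose_mul_self {A : Matrix β β ℝ} (hA : A.PosSemidef) :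
    ∃ B : Matrix β β ℝ, A = Bᵀ * B := by
  obtain ⟨B, hB⟩ := CStarAlgebra.nonneg_iff_eq_star_mul_self.mp hA.nonneg
  exact ⟨B, by rw [hB, Matrix.star_eq_conjTranspose,
    Matrix.conjTranspose_eq_transpose_of_trivial]⟩

theorem Matrix.PosSemidef.trace_mul_le {A B : Matrix β β ℝ} (hA : A.PosSemidef)
    (hB : B.PosSemidef) : (A * B).trace ≤ A.trace * B.trace := by
  obtain ⟨C, rfl⟩ := hA.exists_transpose_mul_self
  obtain ⟨D, rfl⟩ := hB.exists_transpose_mul_self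
  exact trace_transpose_mul_self_mul_le

theorem Matrix.PosSemidef.trace_mul_nonneg {A B : Matrix β β ℝ} (hA : A.PosSemidef)
    (hB : B.PosSemidef) : 0 ≤ (A * B).trace := by
  obtain ⟨C, rfl⟩ := hA.exists_transpose_mul_self
  rw [Matrix.mul_assoc, Matrix.trace_mul_comm]
  have := (hB.mul_mul_conjTranspose_same C).trace_nonneg
  rwa [Matrix.conjTranspose_eq_transpose_of_trivial] at this

end TraceInequality

/-! ### The regularized field and its divergence. -/

section RidgeInverse

open Matrix

variable {α β : Type*} [Fintype α] [Fintype β] [DecidableEq β]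

/-- The regularized inverse `(XᵀX + ε)⁻¹`. -/
noncomputable def ridgeInv (ε : ℝ) (X : Matrix α β ℝ) : Matrix β β ℝ :=
  (Xᵀ * X + ε • (1 : Matrix β β ℝ))⁻¹

omit [DecidableEq β] in
theorem posSemidef_transpose_mul_self (X : Matrix α β ℝ) : (Xᵀ * X).PosSemidef := by
  have := Matrix.posSemidef_conjTranspose_mul_self X
  rwa [Matrix.conjTranspose_eq_transpose_of_trivial] at this

theorem posDef_ridge {ε : ℝ} (hε : 0 < ε) (X : Matrix α β ℝ) :
    (Xᵀ * X + ε • (1 : Matrix β β ℝ)).PosDef :=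
  Matrix.PosDef.posSemidef_add (posSemidef_transpose_mul_self X) (Matrix.PosDef.one.smul hε)

theorem det_ridge_ne_zero {ε : ℝ} (hε : 0 < ε) (X : Matrix α β ℝ) :
    (Xᵀ * X + ε • (1 : Matrix β β ℝ)).det ≠ 0 :=
  (posDef_ridge hε X).det_pos.ne'

theorem posDef_ridgeInv {ε : ℝ} (hε : 0 < ε) (X : Matrix α β ℝ) : (ridgeInv ε X).PosDef :=
  (posDef_ridge hε X).inv

theorem transpose_ridgeInv (ε : ℝ) (X : Matrix α β ℝ) : (ridgeInv ε X)ᵀ = ridgeInv ε X := by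
  simp [ridgeInv, Matrix.transpose_nonsing_inv]

theorem mul_ridgeInv {ε : ℝ} (hε : 0 < ε) (X : Matrix α β ℝ) :
    Xᵀ * X * ridgeInv ε X = 1 - ε • ridgeInv ε X := by
  have := Matrix.mul_nonsing_inv _ (det_ridge_ne_zero hε X).isUnit
  rw [Matrix.add_mul, Matrix.smul_mul, Matrix.one_mul] at this
  exact eq_sub_of_add_eq this

theorem ridgeInv_mul {ε : ℝ} (hε : 0 < ε) (X : Matrix α β ℝ) :
    ridgeInv ε X * (Xᵀ * X) = 1 - ε • ridgeInv ε X := by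
  have := Matrix.nonsing_inv_mul _ (det_ridge_ne_zero hε X).isUnit
  rw [Matrix.mul_add, Matrix.mul_smul, Matrix.mul_one] at this
  exact eq_sub_of_add_eq this

theorem trace_ridgeInv_pos [Nonempty β] {ε : ℝ} (hε : 0 < ε) (X : Matrix α β ℝ) :
    0 < (ridgeInv ε X).trace :=
  (posDef_ridgeInv hε X).trace_pos

theorem continuous_ridgeInv {ε : ℝ} (hε : 0 < ε) :
    Continuous fun X : Matrix α β ℝ => ridgeInv ε X := by
  refine continuous_iff_continuousAt.2 fun X => ?_
  refine tendsto_nonsing_inv (F := fun X : Matrix α β ℝ => Xᵀ * X + ε • (1 : Matrix β β ℝ)) ?_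
    (det_ridge_ne_zero hε X)
  exact ((continuous_id.matrix_transpose.matrix_mul continuous_id).add continuous_const).tendsto X

/-- The vector field `X (2 t R / tr R + t² R² / (tr R)²)` with `R = (XᵀX + ε)⁻¹`. -/
noncomputable def ridgeField (t ε : ℝ) (X : Matrix α β ℝ) : Matrix α β ℝ :=
  (2 * t / (ridgeInv ε X).trace) • (X * ridgeInv ε X) +
    (t ^ 2 / (ridgeInv ε X).trace ^ 2) • (X * ridgeInv ε X * ridgeInv ε X)

/-- The partial derivative of the `(i, j)` entry of `ridgeField` along the `(i, j)` entry. -/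
noncomputable def ridgeFieldDeriv (t ε : ℝ) (X : Matrix α β ℝ) (i : α) (j : β) : ℝ :=
  let R := ridgeInv ε X
  2 * t * ((R j j - (X * R) i j * (X * R) i j - (X * R * Xᵀ) i i * R j j) / R.trace +
      2 * ((X * R) i j * (X * R * R) i j) / R.trace ^ 2) +
    t ^ 2 * (((R * R) j j - 2 * ((X * R) i j * (X * R * R) i j) - (X * R * Xᵀ) i i * (R * R) j j -
      (X * R * R * Xᵀ) i i * R j j) / R.trace ^ 2 +
      4 * ((X * R * R) i j * (X * R * R) i j) / R.trace ^ 3)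

omit [Fintype α] [Fintype β] [DecidableEq β] in
theorem mul_single_mul_apply {κ ι δ δ' : Type*} [Fintype κ] [DecidableEq κ] [Fintype ι]
    [DecidableEq ι] (P : Matrix δ κ ℝ) (M : Matrix ι δ' ℝ) (k : κ) (l : ι) (i : δ) (j : δ') :
    (P * Matrix.single k l (1 : ℝ) * M) i j = P i k * M l j := by
  simp [Matrix.mul_apply, Matrix.single_apply, ite_and]

/-- Along E = E_ij one has dR = -R(EᵀX + XᵀE)R. The rest is the product and quotient rules, each
matrix unit splitting a product into two entries. -/
theorem hasDerivAt_ridgeField [DecidableEq α] [Nonempty β] (t : ℝ) {ε : ℝ} (hε : 0 < ε)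
    (X : Matrix α β ℝ) (i : α) (j : β) :
    HasDerivAt (fun s : ℝ => ridgeField t ε (X + s • Matrix.single i j (1 : ℝ)) i j)
      (ridgeFieldDeriv t ε X i j) 0 := by
  set E : Matrix α β ℝ := Matrix.single i j (1 : ℝ) with hE
  have hEt : Eᵀ = Matrix.single j i (1 : ℝ) := by simp [hE]
  have hX := hasEntryDeriv_add_smul X E
  have hA := (hX.transpose.mul hX).add_const (ε • (1 : Matrix β β ℝ))
  have hR : HasEntryDeriv (fun s => ridgeInv ε (X + s • E)) _ :=
    hA.nonsing_inv fun s => det_ridge_ne_zero hε _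
  have hXR := hX.mul hR
  have hXRR := hXR.mul hR
  have hT := hR.trace
  have hT0 : (ridgeInv ε (X + (0 : ℝ) • E)).trace ≠ 0 := (trace_ridgeInv_pos hε _).ne'
  have h1 := ((hT.inv hT0).const_mul (2 * t)).mul (hXR i j)
  have h2 := (((hT.pow 2).inv (pow_ne_zero 2 hT0)).const_mul (t ^ 2)).mul (hXRR i j)
  have h3 := h1.add h2
  have hX0 : X + (0 : ℝ) • E = X := by simp
  have hRdef : (Xᵀ * X + ε • (1 : Matrix β β ℝ))⁻¹ = ridgeInv ε X := rfl
  rw [hX0] at hT0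
  simp only [Pi.inv_apply, Pi.pow_apply, hX0, hRdef] at h3
  have hRt := transpose_ridgeInv ε X
  set R := ridgeInv ε X with hRR
  have hentry : ∀ (P : Matrix α β ℝ) (M : Matrix β β ℝ),
      (P * (Eᵀ * X + Xᵀ * E) * M) i j = P i j * (X * M) i j + (P * Xᵀ) i i * M j j := by
    intro P M
    rw [Matrix.mul_add, Matrix.add_mul, Matrix.add_apply, hEt, ← Matrix.mul_assoc P,
      Matrix.mul_assoc _ X, mul_single_mul_apply, ← Matrix.mul_assoc P, mul_single_mul_apply]
  have e1 : (E * R) i j = R j j := by simp [hE]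
  have e1' : (E * R * R) i j = (R * R) j j := by
    simp [hE, Matrix.mul_assoc]
  have e2 : (X * -(R * (Eᵀ * X + Xᵀ * E) * R)) i j =
      -((X * R) i j * (X * R) i j + (X * R * Xᵀ) i i * R j j) := by
    rw [← hentry]; simp [Matrix.mul_assoc]
  have e3 : (X * -(R * (Eᵀ * X + Xᵀ * E) * R) * R) i j =
      -((X * R) i j * (X * R * R) i j + (X * R * Xᵀ) i i * (R * R) j j) := by
    rw [Matrix.mul_assoc X R R, ← hentry]; simp [Matrix.mul_assoc]
  have e4 : (X * R * -(R * (Eᵀ * X + Xᵀ * E) * R)) i j =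
      -((X * R * R) i j * (X * R) i j + (X * R * R * Xᵀ) i i * R j j) := by
    rw [← hentry]; simp [Matrix.mul_assoc]
  have e5 : (-(R * (Eᵀ * X + Xᵀ * E) * R)).trace = -(2 * (X * R * R) i j) := by
    -- The two halves are transposes of each other up to cyclic permutation, so they have equal
    -- trace.
    have g1 : (R * (Eᵀ * X + Xᵀ * E) * R).trace = (R * R * (Xᵀ * E)).trace * 2 := by
      rw [Matrix.trace_mul_comm, ← Matrix.mul_assoc, Matrix.mul_add, Matrix.trace_add, mul_two]
      congr 1
      rw [← Matrix.trace_transpose]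
      simp only [Matrix.transpose_mul, Matrix.transpose_transpose, hRt]
      rw [Matrix.trace_mul_comm]
    have g2 : (R * R * (Xᵀ * E)).trace = (X * R * R) i j := by
      have : (X * R * R) i j = ((X * R * R)ᵀ) j i := rfl
      rw [this]
      simp only [Matrix.transpose_mul, hRt, ← Matrix.mul_assoc]
      simp [hE, Matrix.trace, Matrix.mul_apply, Matrix.single_apply, ite_and]
    rw [Matrix.trace_neg, g1, g2, mul_comm]
  refine (h3.congr_deriv ?_).congr_of_eventuallyEq ?_
  · simp only [Matrix.add_apply, Matrix.add_mul, e1, e1', e2, e3, e4, e5, ridgeFieldDeriv,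
      ← hRR]
    field_simp
    ring
  · filter_upwards with s
    simp [ridgeField, div_eq_mul_inv]

omit [DecidableEq β] in
theorem sum_sum_mul_mul (X : Matrix α β ℝ) (M N : Matrix β β ℝ) :
    ∑ i, ∑ j, (X * M) i j * (X * N) i j = (Mᵀ * (Xᵀ * X * N)).trace := by
  have : Mᵀ * (Xᵀ * X * N) = (X * M)ᵀ * (X * N) := by
    simp only [Matrix.transpose_mul, Matrix.mul_assoc]
  rw [this, Finset.sum_comm]
  simp only [Matrix.trace, Matrix.diag, Matrix.mul_apply (M := (X * M)ᵀ), Matrix.transpose_apply]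

omit [DecidableEq β] in
theorem sum_sum_diag_mul_diag (X : Matrix α β ℝ) (M N : Matrix β β ℝ) :
    ∑ i, (X * M * Xᵀ) i i * ∑ j, N j j = (Xᵀ * X * M).trace * N.trace := by
  rw [← Finset.sum_mul, Matrix.mul_assoc Xᵀ, Matrix.trace_mul_comm]
  rfl

/-- Since XᵀX R = 1 - εR, every `X` can be eliminated and only traces of powers of R remain. -/
theorem sum_ridgeFieldDeriv_eq (t : ℝ) {ε : ℝ} (hε : 0 < ε) (X : Matrix α β ℝ) :
    ∑ i, ∑ j, ridgeFieldDeriv t ε X i j =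
      let R := ridgeInv ε X
      let T := R.trace
      let T2 := (R * R).trace
      let T3 := (R * R * R).trace
      let T4 := (R * R * R * R).trace
      2 * t * ((Fintype.card α * T - (T - ε * T2) - (Fintype.card β - ε * T) * T) / T +
        2 * (T2 - ε * T3) / T ^ 2) +
      t ^ 2 * ((Fintype.card α * T2 - 2 * (T2 - ε * T3) - (Fintype.card β - ε * T) * T2 -
        (T - ε * T2) * T) / T ^ 2 + 4 * (T3 - ε * T4) / T ^ 3) := by
  have hRt := transpose_ridgeInv ε X
  have hA := mul_ridgeInv hε X
  simp only [ridgeFieldDeriv]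
  set R := ridgeInv ε X
  have s1 : ∑ i : α, ∑ j : β, R j j = Fintype.card α * R.trace := by
    simp [Matrix.trace]
  have s1' : ∑ i : α, ∑ j : β, (R * R) j j = Fintype.card α * (R * R).trace := by
    simp [Matrix.trace]
  have s2 := sum_sum_mul_mul X R R
  have s3 := sum_sum_mul_mul X R (R * R)
  have s4 := sum_sum_mul_mul X (R * R) (R * R)
  have s5 := sum_sum_diag_mul_diag X R R
  have s6 := sum_sum_diag_mul_diag X R (R * R)
  have s7 := sum_sum_diag_mul_diag X (R * R) R
  simp only [Matrix.transpose_mul, hRt, ← Matrix.mul_assoc X R R,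
    ← Matrix.mul_assoc (Xᵀ * X) R R, hA, Matrix.mul_sub, Matrix.sub_mul, Matrix.mul_one,
    Matrix.one_mul, Matrix.mul_smul, Matrix.smul_mul, Matrix.trace_sub, Matrix.trace_smul,
    Matrix.trace_one, smul_eq_mul, ← Matrix.mul_assoc] at s2 s3 s4 s5 s6 s7
  simp only [Finset.sum_add_distrib, Finset.sum_sub_distrib, ← Finset.mul_sum, ← Finset.sum_div,
    s1, s1', s2, s3, s4, s5, s6, s7]

/-- At ε = 0, with a rows and b columns, the divergence is 2t(a - b - 1 + 2x) + t²((a - b - 2)x - 1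
+ 4y), where x = tr R²/(tr R)² and y = tr R³/(tr R)³. As y ≤ x ≤ 1, it is at most 2t(a - b + 1) +
t²(a - b + 1). The last term of the bound absorbs the effect of ε. -/
theorem sum_ridgeFieldDeriv_le [Nonempty β] {t ε : ℝ} (ht0 : 0 ≤ t) (hε : 0 < ε)
    (X : Matrix α β ℝ) (hcard : Fintype.card β ≤ Fintype.card α)
    (ht : t * ((Fintype.card α : ℝ) - Fintype.card β + 1) ≤ 2 * ((Fintype.card β : ℝ) - 1)) :
    ∑ i, ∑ j, ridgeFieldDeriv t ε X i j ≤
      2 * t * Fintype.card α + (4 * t + 4 * t ^ 2) * (ε * (ridgeInv ε X).trace) := by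
  rw [sum_ridgeFieldDeriv_eq t hε X]
  have hR := (posDef_ridgeInv hε X).posSemidef
  have hRt := transpose_ridgeInv ε X
  have hT := trace_ridgeInv_pos hε X
  have hRR : (ridgeInv ε X * ridgeInv ε X).PosSemidef := by
    simpa [hRt] using posSemidef_transpose_mul_self (ridgeInv ε X)
  have h2 := hR.trace_mul_le hR
  have h3 := hRR.trace_mul_le hR
  have p2 := hR.trace_mul_nonneg hR
  have p3 := hRR.trace_mul_nonneg hR
  have p4 := hRR.trace_mul_nonneg hRR
  rw [← Matrix.mul_assoc] at p4
  have hd : (0 : ℝ) ≤ (Fintype.card α : ℝ) - Fintype.card β := by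
    rw [sub_nonneg]; exact_mod_cast hcard
  simp only
  generalize (ridgeInv ε X).trace = T at *
  generalize (ridgeInv ε X * ridgeInv ε X).trace = T2 at *
  generalize (ridgeInv ε X * ridgeInv ε X * ridgeInv ε X).trace = T3 at *
  generalize (ridgeInv ε X * ridgeInv ε X * ridgeInv ε X * ridgeInv ε X).trace = T4 at *
  generalize (Fintype.card α : ℝ) = a at *
  generalize (Fintype.card β : ℝ) = b at *
  -- These scale-free ratios turn the estimate into a polynomial inequality in x, y and ε tr R.
  obtain ⟨x, hx⟩ : ∃ x, x = T2 / T ^ 2 := ⟨_, rfl⟩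
  obtain ⟨y, hy⟩ : ∃ y, y = T3 / T ^ 3 := ⟨_, rfl⟩
  have hT2 : T2 = x * T ^ 2 := by rw [hx]; field_simp
  have hT3 : T3 = y * T ^ 3 := by rw [hy]; field_simp
  have hx0 : 0 ≤ x := by rw [hx]; positivity
  have hy0 : 0 ≤ y := by rw [hy]; positivity
  have hx1 : x ≤ 1 := by rw [hx, div_le_one (by positivity)]; linarith
  have hyx : y ≤ x := by
    rw [hx, hy, div_le_div_iff₀ (by positivity) (by positivity)]
    nlinarith [mul_le_mul_of_nonneg_right h3 (sq_nonneg T)]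
  have he : 0 ≤ ε * T := by positivity
  have b1 : (a * T - (T - ε * T2) - (b - ε * T) * T) / T + 2 * (T2 - ε * T3) / T ^ 2 ≤
      (a - b) - 1 + 2 * (ε * T) + 2 * x := by
    have : (a * T - (T - ε * T2) - (b - ε * T) * T) / T + 2 * (T2 - ε * T3) / T ^ 2 =
        (a - b) - 1 + (1 + x) * (ε * T) + 2 * x - 2 * y * (ε * T) := by
      rw [hT2, hT3]; field_simp; ring
    rw [this]
    nlinarith [mul_nonneg hy0 he, mul_nonneg (sub_nonneg.2 hx1) he]
  have b2 : (a * T2 - 2 * (T2 - ε * T3) - (b - ε * T) * T2 - (T - ε * T2) * T) / T ^ 2 +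
      4 * (T3 - ε * T4) / T ^ 3 ≤ (a - b - 2) * x - 1 + 4 * (ε * T) + 4 * y := by
    have : (a * T2 - 2 * (T2 - ε * T3) - (b - ε * T) * T2 - (T - ε * T2) * T) / T ^ 2 +
      4 * (T3 - ε * T4) / T ^ 3 =
        (a - b - 2) * x - 1 + (2 * x + 2 * y) * (ε * T) + 4 * y - 4 * ε * (T4 / T ^ 3) := by
      rw [hT2, hT3]; field_simp; ring
    rw [this]
    have : 0 ≤ 4 * ε * (T4 / T ^ 3) := by positivity
    nlinarith [mul_nonneg (sub_nonneg.2 hx1) he, mul_nonneg (sub_nonneg.2 (hyx.trans hx1)) he]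
  have b3 : (a - b - 2) * x - 1 + 4 * (ε * T) + 4 * y ≤ (a - b + 1) + 4 * (ε * T) := by
    nlinarith [mul_nonneg hd (sub_nonneg.2 hx1)]
  calc _ ≤ 2 * t * ((a - b) + 1 + 2 * (ε * T)) + t ^ 2 * ((a - b + 1) + 4 * (ε * T)) := by
        refine add_le_add (mul_le_mul_of_nonneg_left ?_ (by positivity))
          (mul_le_mul_of_nonneg_left (b2.trans b3) (by positivity))
        linarith
    _ = t * (2 * ((a - b) + 1) + t * (a - b + 1)) + (4 * t + 4 * t ^ 2) * (ε * T) := by ring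
    -- The only use of the upper bound on t; it is exactly what makes the bracket collapse to 2a.
    _ ≤ t * (2 * ((a - b) + 1) + 2 * (b - 1)) + (4 * t + 4 * t ^ 2) * (ε * T) := by
        gcongr
    _ = _ := by ring

/-- The difference of the two sides is tr(XᵀX R) ≥ 0. This gives a bound uniform in ε and X for
dominated convergence. -/
theorem mul_trace_ridgeInv_le {ε : ℝ} (hε : 0 < ε) (X : Matrix α β ℝ) :
    ε * (ridgeInv ε X).trace ≤ Fintype.card β := by
  have h := (posSemidef_transpose_mul_self X).trace_mul_nonneg (posDef_ridgeInv hε X).posSemidef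
  rw [mul_ridgeInv hε, Matrix.trace_sub, Matrix.trace_one, Matrix.trace_smul, smul_eq_mul] at h
  linarith

theorem continuous_ridgeField [Nonempty β] (t : ℝ) {ε : ℝ} (hε : 0 < ε) :
    Continuous fun X : Matrix α β ℝ => ridgeField t ε X := by
  have hR := continuous_ridgeInv (α := α) (β := β) hε
  have hT := hR.matrix_trace
  have h0 : ∀ X : Matrix α β ℝ, (ridgeInv ε X).trace ≠ 0 := fun X => (trace_ridgeInv_pos hε X).ne'
  have hXR := continuous_id.matrix_mul hR
  exact ((continuous_const.div hT h0).smul hXR).add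
    ((continuous_const.div (hT.pow 2) fun X => pow_ne_zero 2 (h0 X)).smul (hXR.matrix_mul hR))

theorem continuous_ridgeFieldDeriv [Nonempty β] (t : ℝ) {ε : ℝ} (hε : 0 < ε) (i : α) (j : β) :
    Continuous fun X : Matrix α β ℝ => ridgeFieldDeriv t ε X i j := by
  have hR := continuous_ridgeInv (α := α) (β := β) hε
  have hT := hR.matrix_trace
  have h0 : ∀ X : Matrix α β ℝ, (ridgeInv ε X).trace ≠ 0 := fun X => (trace_ridgeInv_pos hε X).ne'
  have hXR : Continuous fun X : Matrix α β ℝ => X * ridgeInv ε X := continuous_id.matrix_mul hR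
  have hXRR := hXR.matrix_mul hR
  have c1 := hR.matrix_elem j j
  have c2 := hXR.matrix_elem i j
  have c3 := hXRR.matrix_elem i j
  have c4 := (hXR.matrix_mul continuous_id.matrix_transpose).matrix_elem i i
  have c5 := (hXRR.matrix_mul continuous_id.matrix_transpose).matrix_elem i i
  have c6 := (hR.matrix_mul hR).matrix_elem j j
  simp only [id_eq] at c4 c5
  unfold ridgeFieldDeriv
  simp only
  refine (continuous_const.mul (Continuous.add (Continuous.div ?_ hT h0)
    (Continuous.div ?_ (hT.pow 2) fun X => pow_ne_zero 2 (h0 X)))).add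
    (continuous_const.mul (Continuous.add
      (Continuous.div ?_ (hT.pow 2) fun X => pow_ne_zero 2 (h0 X))
      (Continuous.div ?_ (hT.pow 3) fun X => pow_ne_zero 3 (h0 X)))) <;> fun_prop

end RidgeInverse

/-! ### Integration by parts for the test generator and removal of the regularization. -/

section IntegrationByParts

open Matrix Filter Topology Module

theorem hasDerivAt_max_zero_sq (r : ℝ) :
    HasDerivAt (fun r : ℝ => max r 0 ^ 2) (2 * max r 0) r := by
  rcases lt_trichotomy r 0 with h | h | h
  · rw [max_eq_right h.le, mul_zero]
    refine (hasDerivAt_const r (0 : ℝ)).congr_of_eventuallyEq ?_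
    filter_upwards [Iio_mem_nhds h] with s hs
    rw [max_eq_right (le_of_lt hs)]; simp
  · subst h
    rw [hasDerivAt_iff_isLittleO_nhds_zero]
    refine (Asymptotics.IsBigO.of_bound 1 ?_).trans_isLittleO
      (Asymptotics.isLittleO_pow_id (𝕜 := ℝ) one_lt_two)
    filter_upwards with s
    rcases le_total s 0 with hs | hs
    · simp [max_eq_right hs, sq_nonneg]
    · simp [max_eq_left hs]
  · rw [max_eq_left h.le]
    have := (hasDerivAt_id r).pow 2
    refine (this.congr_deriv (by simp)).congr_of_eventuallyEq ?_
    filter_upwards [Ioi_mem_nhds h] with s hs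
    rw [max_eq_left (le_of_lt hs)]; simp

variable {E : Type*} [NormedAddCommGroup E] [NormedSpace ℝ E] [FiniteDimensional ℝ E]

theorem hasCompactSupport_max_one_sub {Q : E → ℝ} (hQc : Continuous Q)
    (hQh : ∀ (s : ℝ) (x : E), Q (s • x) = s ^ 2 * Q x) (hQp : ∀ x, x ≠ 0 → 0 < Q x) :
    HasCompactSupport fun x => max (1 - Q x) 0 := by
  refine HasCompactSupport.of_support_subset_isCompact
    (Metric.isCompact_of_isClosed_isBounded (isClosed_le hQc continuous_const)
      (isBounded_setOf_le hQc hQh hQp 1)) fun x hx => ?_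
  by_contra h
  have h1 : 1 < Q x := not_le.1 h
  exact hx (max_eq_right (by linarith))

variable [MeasurableSpace E] [BorelSpace E] (μ : Measure E) [μ.IsAddHaarMeasure]

/-- The derivative of (1-Q)₊² along `e` is -4(1-Q)₊ L, so this is one integration by parts; compact
support of (1-Q)₊ settles integrability and removes boundary terms. -/
theorem integral_four_mul_max_mul_eq {Q : E → ℝ} (hQc : Continuous Q)
    (hQs : HasCompactSupport fun x => max (1 - Q x) 0) {e : E} {L h h' : E → ℝ}
    (hL : Continuous L) (hh : Continuous h) (hh' : Continuous h')
    (hQd : ∀ x, HasLineDerivAt ℝ Q (2 * L x) x e) (hhd : ∀ x, HasLineDerivAt ℝ h (h' x) x e) :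
    ∫ x, 4 * max (1 - Q x) 0 * (L x * h x) ∂μ = ∫ x, max (1 - Q x) 0 ^ 2 * h' x ∂μ := by
  have hd : ∀ x, HasLineDerivAt ℝ (fun x => max (1 - Q x) 0 ^ 2)
      (-(4 * max (1 - Q x) 0 * L x)) x e := by
    intro x
    have h1 : HasDerivAt (fun s : ℝ => 1 - Q (x + s • e)) (-(2 * L x)) 0 := (hQd x).const_sub 1
    have h2 := HasDerivAt.comp (0 : ℝ) (hasDerivAt_max_zero_sq (1 - Q (x + (0 : ℝ) • e))) h1
    refine h2.congr_deriv ?_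
    simp; ring
  have hi : ∀ k : E → ℝ, Continuous k → Integrable (fun x => max (1 - Q x) 0 * k x) μ := by
    intro k hk
    exact ((by fun_prop : Continuous fun x => max (1 - Q x) 0).mul
      hk).integrable_of_hasCompactSupport hQs.mul_right
  have := integral_bilinear_hasLineDerivAt_right_eq_neg_left_of_integrable (μ := μ)
    (B := ContinuousLinearMap.mul ℝ ℝ) (f := fun x => max (1 - Q x) 0 ^ 2)
    (f' := fun x => -(4 * max (1 - Q x) 0 * L x)) (g := h) (g' := h') (v := e)
    ?_ ?_ ?_ (fun x _ => hd x) (fun x _ => hhd x)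
  · simp only [ContinuousLinearMap.mul_apply'] at this
    rw [this, ← integral_neg]
    congr 1
    ext x; ring
  · refine (hi (fun x => -(4 * L x * h x)) (by fun_prop)).congr (ae_of_all _ fun x => ?_)
    simp only [ContinuousLinearMap.mul_apply']; ring
  · refine (hi (fun x => max (1 - Q x) 0 * h' x) (by fun_prop)).congr (ae_of_all _ fun x => ?_)
    simp only [ContinuousLinearMap.mul_apply']; ring
  · refine (hi (fun x => max (1 - Q x) 0 * h x) (by fun_prop)).congr (ae_of_all _ fun x => ?_)
    simp only [ContinuousLinearMap.mul_apply']; ring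

variable {α β : Type*} [Fintype α] [Fintype β] [DecidableEq α] [DecidableEq β]

theorem exists_transpose_mul_self_eq_one (hcard : Fintype.card β ≤ Fintype.card α) :
    ∃ Y : Matrix α β ℝ, Yᵀ * Y = 1 := by
  obtain ⟨φ⟩ := Function.Embedding.nonempty_of_card_le hcard
  refine ⟨Matrix.of fun i j => if i = φ j then 1 else 0, ?_⟩
  ext j k
  simp only [Matrix.mul_apply, Matrix.transpose_apply, Matrix.of_apply, mul_ite, mul_one, mul_zero,
    Finset.sum_ite_eq', Finset.mem_univ, if_true, Matrix.one_apply]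
  simp [eq_comm]

omit [DecidableEq α] in
-- The determinant is a polynomial in s, so only its not vanishing identically is at issue.
theorem finite_setOf_det_line_eq_zero (A Y : Matrix α β ℝ) (hY : Yᵀ * Y = 1) :
    {s : ℝ | ((A + s • Y)ᵀ * (A + s • Y)).det = 0}.Finite := by
  classical
  let M : Matrix α β (Polynomial ℝ) :=
    A.map Polynomial.C + (Polynomial.X : Polynomial ℝ) • Y.map Polynomial.C
  have heval : ∀ s : ℝ, (Mᵀ * M).det.eval s = ((A + s • Y)ᵀ * (A + s • Y)).det := by
    intro s
    rw [← Polynomial.coe_evalRingHom, RingHom.map_det]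
    congr 1
    ext i j
    simp only [M, Matrix.mul_apply, RingHom.mapMatrix_apply, Matrix.map_apply, Matrix.transpose_apply,
      Matrix.add_apply, Matrix.smul_apply, smul_eq_mul, Polynomial.coe_evalRingHom,
      Polynomial.eval_finsetSum, Polynomial.eval_mul, Polynomial.eval_add, Polynomial.eval_C,
      Polynomial.eval_X]
  have hne : (Mᵀ * M).det ≠ 0 := by
    intro h0
    have hz : ∀ s : ℝ, ((A + s • Y)ᵀ * (A + s • Y)).det = 0 := fun s => by
      rw [← heval, h0, Polynomial.eval_zero]
    -- Looking from infinity, r = 1/s: a polynomial vanishing identically would force the value at r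
    -- = 0, which is det(YᵀY) = 1, to vanish by continuity.
    have hc : Continuous fun r : ℝ => ((r • A + Y)ᵀ * (r • A + Y)).det := by
      have : Continuous fun r : ℝ => r • A + Y := by fun_prop
      exact (this.matrix_transpose.matrix_mul this).matrix_det
    have h1 : ∀ r : ℝ, r ≠ 0 → ((r • A + Y)ᵀ * (r • A + Y)).det = 0 := by
      intro r hr
      have : r • A + Y = r • (A + r⁻¹ • Y) := by
        rw [smul_add, smul_smul, mul_inv_cancel₀ hr, one_smul]
      rw [this, Matrix.transpose_smul, Matrix.smul_mul, Matrix.mul_smul, Matrix.det_smul,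
        Matrix.det_smul, hz]
      simp
    have h2 : (fun r : ℝ => ((r • A + Y)ᵀ * (r • A + Y)).det) = fun _ => 0 :=
      Continuous.ext_on (dense_compl_singleton (0 : ℝ)) hc continuous_const
        fun r hr => h1 r hr
    have h3 := congrFun h2 0
    simp [hY] at h3
  refine (Multiset.finite_toSet (Mᵀ * M).det.roots).subset fun s hs => ?_
  rw [mem_ofPred_eq, Polynomial.mem_roots hne, Polynomial.IsRoot, heval]
  exact hs

omit [DecidableEq α] in
-- On every line in a direction mapped to a matrix with orthonormal columns the exceptional set is
-- finite; Fubini along these lines makes it null.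
theorem ae_det_transpose_mul_self_ne_zero (X : E →ₗ[ℝ] Matrix α β ℝ)
    (hX : Function.Surjective X) (hcard : Fintype.card β ≤ Fintype.card α) :
    ∀ᵐ w ∂μ, ((X w)ᵀ * X w).det ≠ 0 := by
  classical
  obtain ⟨Y, hY⟩ := exists_transpose_mul_self_eq_one (α := α) (β := β) hcard
  obtain ⟨w₀, hw₀⟩ := hX Y
  have hXc : Continuous X := LinearMap.continuous_of_finiteDimensional X
  have hm : MeasurableSet {w | ((X w)ᵀ * X w).det ≠ 0} :=
    (isOpen_ne_fun (hXc.matrix_transpose.matrix_mul hXc).matrix_det continuous_const).measurableSet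
  refine ae_mem_of_ae_add_linearMap_mem (LinearMap.toSpanSingleton ℝ E w₀)
    (volume : Measure ℝ) μ hm fun y => ?_
  have := (finite_setOf_det_line_eq_zero (X y) Y hY).measure_zero volume
  rw [ae_iff]
  refine measure_mono_null (fun s hs => ?_) this
  have hs' : ¬ ((X (y + s • w₀))ᵀ * X (y + s • w₀)).det ≠ 0 := hs
  rw [map_add, map_smul, hw₀, not_not] at hs'
  exact hs'

omit [DecidableEq α] in
theorem tendsto_ridgeInv {X : Matrix α β ℝ} (hX : (Xᵀ * X).det ≠ 0) {ε : ℕ → ℝ}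
    (hε : Tendsto ε atTop (𝓝 0)) :
    Tendsto (fun n => ridgeInv (ε n) X) atTop (𝓝 (ridgeInv 0 X)) := by
  refine tendsto_nonsing_inv ?_ (by simpa using hX)
  exact tendsto_const_nhds.add (hε.smul_const _)

omit [DecidableEq α] in
theorem posDef_ridgeInv_zero {X : Matrix α β ℝ} (hX : (Xᵀ * X).det ≠ 0) :
    (ridgeInv 0 X).PosDef := by
  simp only [ridgeInv, zero_smul, add_zero]
  exact ((posSemidef_transpose_mul_self X).posDef_iff_det_ne_zero.2 hX).inv

omit [DecidableEq α] in
theorem tendsto_ridgeField [Nonempty β] (t : ℝ) {X : Matrix α β ℝ} (hX : (Xᵀ * X).det ≠ 0)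
    {ε : ℕ → ℝ} (hε : Tendsto ε atTop (𝓝 0)) :
    Tendsto (fun n => ridgeField t (ε n) X) atTop (𝓝 (ridgeField t 0 X)) := by
  have hR := tendsto_ridgeInv hX hε
  have hT : Tendsto (fun n => (ridgeInv (ε n) X).trace) atTop (𝓝 (ridgeInv 0 X).trace) :=
    (continuous_id.matrix_trace.tendsto _).comp hR
  have h0 : (ridgeInv 0 X).trace ≠ 0 := (posDef_ridgeInv_zero hX).trace_pos.ne'
  have hXR : Tendsto (fun n => X * ridgeInv (ε n) X) atTop (𝓝 (X * ridgeInv 0 X)) :=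
    ((continuous_const.matrix_mul continuous_id : Continuous fun R : Matrix β β ℝ =>
      X * R).tendsto _).comp hR
  have hXRR : Tendsto (fun n => X * ridgeInv (ε n) X * ridgeInv (ε n) X) atTop
      (𝓝 (X * ridgeInv 0 X * ridgeInv 0 X)) := by
    simp only [Matrix.mul_assoc]
    exact ((continuous_const.matrix_mul continuous_id : Continuous fun R : Matrix β β ℝ =>
      X * R).tendsto _).comp (hR.mul hR)
  exact ((tendsto_const_nhds.div hT h0).smul hXR).add
    ((tendsto_const_nhds.div (hT.pow 2) (pow_ne_zero 2 h0)).smul hXRR)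

/-- The pairing of a matrix field `L` with the field `ridgeField t ε`. -/
noncomputable def ridgePairing (t ε : ℝ) (L X : Matrix α β ℝ) : ℝ :=
  ∑ i, ∑ j, L i j * ridgeField t ε X i j

theorem integral_four_mul_max_mul_ridgePairing_eq [Nonempty β] {Q : E → ℝ} (hQc : Continuous Q)
    (hQs : HasCompactSupport fun x => max (1 - Q x) 0) (X : E →ₗ[ℝ] Matrix α β ℝ)
    {e : α → β → E} (he : ∀ i j, X (e i j) = Matrix.single i j 1) {L : E → Matrix α β ℝ}
    (hL : Continuous L) (hQd : ∀ x i j, HasLineDerivAt ℝ Q (2 * L x i j) x (e i j))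
    (t : ℝ) {ε : ℝ} (hε : 0 < ε) :
    ∫ w, 4 * max (1 - Q w) 0 * ridgePairing t ε (L w) (X w) ∂μ =
      ∫ w, max (1 - Q w) 0 ^ 2 * ∑ i, ∑ j, ridgeFieldDeriv t ε (X w) i j ∂μ := by
  have hXc : Continuous X := LinearMap.continuous_of_finiteDimensional X
  have hm : Continuous fun x => max (1 - Q x) 0 := by fun_prop
  have hh : ∀ i j, Continuous fun w => ridgeField t ε (X w) i j := fun i j =>
    ((continuous_ridgeField t hε).comp hXc).matrix_elem i j
  have hh' : ∀ i j, Continuous fun w => ridgeFieldDeriv t ε (X w) i j := fun i j =>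
    (continuous_ridgeFieldDeriv t hε i j).comp hXc
  have hLc : ∀ i j, Continuous fun w => L w i j := fun i j => hL.matrix_elem i j
  have hi : ∀ k : E → ℝ, Continuous k → Integrable (fun x => max (1 - Q x) 0 * k x) μ := by
    intro k hk
    exact (hm.mul hk).integrable_of_hasCompactSupport hQs.mul_right
  simp only [ridgePairing, Finset.mul_sum]
  have i1 : ∀ i j, Integrable (fun w => 4 * max (1 - Q w) 0 *
      (L w i j * ridgeField t ε (X w) i j)) μ := fun i j =>
    (hi (fun w => 4 * (L w i j * ridgeField t ε (X w) i j))
      (continuous_const.mul ((hLc i j).mul (hh i j)))).congr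
      (ae_of_all _ fun w => by simp only; ring)
  have i2 : ∀ i j, Integrable (fun w => max (1 - Q w) 0 ^ 2 * ridgeFieldDeriv t ε (X w) i j) μ :=
    fun i j => (hi (fun w => max (1 - Q w) 0 * ridgeFieldDeriv t ε (X w) i j)
      (hm.mul (hh' i j))).congr (ae_of_all _ fun w => by simp only; ring)
  rw [integral_finsetSum _ fun i _ => integrable_finsetSum _ fun j _ => i1 i j,
    integral_finsetSum _ fun i _ => integrable_finsetSum _ fun j _ => i2 i j]
  refine Finset.sum_congr rfl fun i _ => ?_
  rw [integral_finsetSum _ fun j _ => i1 i j, integral_finsetSum _ fun j _ => i2 i j]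
  refine Finset.sum_congr rfl fun j _ => ?_
  refine integral_four_mul_max_mul_eq μ hQc hQs (hLc i j) (hh i j) (hh' i j)
    (fun x => hQd x i j) fun x => ?_
  have := hasDerivAt_ridgeField t hε (X x) i j
  refine this.congr_of_eventuallyEq (Eventually.of_forall fun s => ?_)
  simp [he]

/-- For ε > 0, integrate by parts and bound the divergence. Then let ε = 1/(n+1) → 0: Fatou suffices
on the left because the pairing is nonnegative, and dominated convergence kills the error C ε tr R
on the right, R having a finite limit almost everywhere. -/
theorem lintegral_four_mul_max_mul_ridgePairing_le [Nonempty β] {Q : E → ℝ} (hQc : Continuous Q)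
    (hQs : HasCompactSupport fun x => max (1 - Q x) 0) (X : E →ₗ[ℝ] Matrix α β ℝ)
    {e : α → β → E} (he : ∀ i j, X (e i j) = Matrix.single i j 1) {L : E → Matrix α β ℝ}
    (hL : Continuous L) (hQd : ∀ x i j, HasLineDerivAt ℝ Q (2 * L x i j) x (e i j))
    {t : ℝ} (ht0 : 0 ≤ t) (hcard : Fintype.card β ≤ Fintype.card α)
    (ht : t * ((Fintype.card α : ℝ) - Fintype.card β + 1) ≤ 2 * ((Fintype.card β : ℝ) - 1))
    (hpos : ∀ w ε, 0 < ε → 0 ≤ ridgePairing t ε (L w) (X w)) :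
    ∫⁻ w, ENNReal.ofReal (4 * max (1 - Q w) 0) *
        ENNReal.ofReal (ridgePairing t 0 (L w) (X w)) ∂μ ≤
      ENNReal.ofReal (2 * t * Fintype.card α) *
        ∫⁻ w, ENNReal.ofReal (max (1 - Q w) 0 ^ 2) ∂μ := by
  have hXc : Continuous X := LinearMap.continuous_of_finiteDimensional X
  have hXs : Function.Surjective X := by
    intro Y
    refine ⟨∑ i, ∑ j, Y i j • e i j, ?_⟩
    simp only [map_sum, map_smul, he]
    conv_rhs => rw [Matrix.matrix_eq_sum_single Y]
    simp
  have hm : Continuous fun x => max (1 - Q x) 0 := by fun_prop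
  have hi : ∀ k : E → ℝ, Continuous k → Integrable (fun x => max (1 - Q x) 0 * k x) μ := by
    intro k hk
    exact (hm.mul hk).integrable_of_hasCompactSupport hQs.mul_right
  have hi2 : ∀ k : E → ℝ, Continuous k → Integrable (fun x => max (1 - Q x) 0 ^ 2 * k x) μ := by
    intro k hk
    exact (hi (fun x => max (1 - Q x) 0 * k x) (hm.mul hk)).congr
      (ae_of_all _ fun w => by simp only; ring)
  have hm0 : ∀ w, 0 ≤ max (1 - Q w) 0 := fun w => le_max_right _ _
  set M : ℝ := 2 * t * Fintype.card α with hMdef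
  have hM0 : 0 ≤ M := by positivity
  set C : ℝ := 4 * t + 4 * t ^ 2 with hCdef
  have hC0 : 0 ≤ C := by positivity
  let ε : ℕ → ℝ := fun n => 1 / ((n : ℝ) + 1)
  have hε : ∀ n, 0 < ε n := fun n => by positivity
  have hεlim : Tendsto ε atTop (𝓝 0) := tendsto_one_div_add_atTop_nhds_zero_nat
  have hae := ae_det_transpose_mul_self_ne_zero μ X hXs hcard
  have hFc : ∀ n, Continuous fun w => ridgePairing t (ε n) (L w) (X w) := fun n =>
    continuous_finsetSum _ fun i _ => continuous_finsetSum _ fun j _ =>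
      (hL.matrix_elem i j).mul (((continuous_ridgeField t (hε n)).comp hXc).matrix_elem i j)
  have hTc : ∀ n, Continuous fun w => ε n * (ridgeInv (ε n) (X w)).trace := fun n =>
    continuous_const.mul ((continuous_ridgeInv (hε n)).comp hXc).matrix_trace
  have hDc : ∀ n, Continuous fun w => ∑ i, ∑ j, ridgeFieldDeriv t (ε n) (X w) i j := fun n =>
    continuous_finsetSum _ fun i _ => continuous_finsetSum _ fun j _ =>
      (continuous_ridgeFieldDeriv t (hε n) i j).comp hXc
  have hT0 : ∀ n w, 0 ≤ ε n * (ridgeInv (ε n) (X w)).trace := fun n w =>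
    mul_nonneg (hε n).le (trace_ridgeInv_pos (hε n) (X w)).le
  have hstep : ∀ n, ∫⁻ w, ENNReal.ofReal (4 * max (1 - Q w) 0 *
        ridgePairing t (ε n) (L w) (X w)) ∂μ ≤
      ENNReal.ofReal (∫ w, max (1 - Q w) 0 ^ 2 *
        (M + C * (ε n * (ridgeInv (ε n) (X w)).trace)) ∂μ) := by
    intro n
    rw [← ofReal_integral_eq_lintegral_ofReal,
      integral_four_mul_max_mul_ridgePairing_eq μ hQc hQs X he hL hQd t (hε n)]
    · refine ENNReal.ofReal_le_ofReal (integral_mono (hi2 _ (hDc n))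
        (hi2 _ (continuous_const.add (continuous_const.mul (hTc n)))) fun w => ?_)
      exact mul_le_mul_of_nonneg_left (sum_ridgeFieldDeriv_le ht0 (hε n) (X w) hcard ht)
        (sq_nonneg _)
    · exact (hi (fun w => 4 * ridgePairing t (ε n) (L w) (X w))
        (continuous_const.mul (hFc n))).congr (ae_of_all _ fun w => by simp only; ring)
    · exact ae_of_all _ fun w => mul_nonneg (mul_nonneg (by norm_num) (hm0 w)) (hpos w _ (hε n))
  have hlim : Tendsto (fun n => ∫ w, max (1 - Q w) 0 ^ 2 *
      (M + C * (ε n * (ridgeInv (ε n) (X w)).trace)) ∂μ) atTop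
      (𝓝 (∫ w, max (1 - Q w) 0 ^ 2 * (M + C * (0 * (ridgeInv 0 (X w)).trace)) ∂μ)) := by
    refine tendsto_integral_of_dominated_convergence
      (fun w => max (1 - Q w) 0 ^ 2 * (M + C * Fintype.card β))
      (fun n => ((hm.pow 2).mul (continuous_const.add (continuous_const.mul
        (hTc n)))).aestronglyMeasurable) (hi2 _ continuous_const) (fun n => ae_of_all _ fun w => ?_)
      ?_
    · rw [Real.norm_eq_abs, abs_of_nonneg (mul_nonneg (sq_nonneg _)
        (add_nonneg hM0 (mul_nonneg hC0 (hT0 n w))))]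
      gcongr
      exact mul_trace_ridgeInv_le (hε n) (X w)
    · filter_upwards [hae] with w hw
      exact tendsto_const_nhds.mul (tendsto_const_nhds.add (tendsto_const_nhds.mul
        (hεlim.mul ((continuous_id.matrix_trace.tendsto _).comp (tendsto_ridgeInv hw hεlim)))))
  calc ∫⁻ w, ENNReal.ofReal (4 * max (1 - Q w) 0) *
        ENNReal.ofReal (ridgePairing t 0 (L w) (X w)) ∂μ
      = ∫⁻ w, liminf (fun n => ENNReal.ofReal (4 * max (1 - Q w) 0 *
          ridgePairing t (ε n) (L w) (X w))) atTop ∂μ := by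
        refine lintegral_congr_ae ?_
        filter_upwards [hae] with w hw
        have hl : Tendsto (fun n => ridgePairing t (ε n) (L w) (X w)) atTop
            (𝓝 (ridgePairing t 0 (L w) (X w))) := by
          refine tendsto_finsetSum _ fun i _ => tendsto_finsetSum _ fun j _ => ?_
          exact tendsto_const_nhds.mul ((tendsto_pi_nhds.1 (tendsto_pi_nhds.1
            (tendsto_ridgeField t hw hεlim) i)) j)
        rw [← ENNReal.ofReal_mul (mul_nonneg (by norm_num) (hm0 w))]
        exact (ENNReal.tendsto_ofReal (tendsto_const_nhds.mul hl)).liminf_eq.symm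
    _ ≤ liminf (fun n => ∫⁻ w, ENNReal.ofReal (4 * max (1 - Q w) 0 *
          ridgePairing t (ε n) (L w) (X w)) ∂μ) atTop :=
        lintegral_liminf_le fun n =>
          ((continuous_const.mul hm).mul (hFc n)).measurable.ennreal_ofReal
    _ ≤ liminf (fun n => ENNReal.ofReal (∫ w, max (1 - Q w) 0 ^ 2 *
          (M + C * (ε n * (ridgeInv (ε n) (X w)).trace)) ∂μ)) atTop :=
        liminf_le_liminf (Eventually.of_forall hstep)
    _ = ENNReal.ofReal (∫ w, max (1 - Q w) 0 ^ 2 *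
          (M + C * (0 * (ridgeInv 0 (X w)).trace)) ∂μ) :=
        (ENNReal.tendsto_ofReal hlim).liminf_eq
    _ = ENNReal.ofReal M * ∫⁻ w, ENNReal.ofReal (max (1 - Q w) 0 ^ 2) ∂μ := by
        simp only [zero_mul, mul_zero, add_zero]
        rw [integral_mul_const, mul_comm, ENNReal.ofReal_mul hM0,
          ofReal_integral_eq_lintegral_ofReal]
        · simpa using hi2 (fun _ => 1) continuous_const
        · exact ae_of_all _ fun w => sq_nonneg _

end IntegrationByParts

/-! ### Homogeneity and measurability of the unregularized pairing. -/

section HomogeneousField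

open Matrix Filter Topology Module

variable {α β : Type*} [Fintype α] [Fintype β] [DecidableEq β]

theorem ridgeInv_zero_smul {s : ℝ} (hs : s ≠ 0) (X : Matrix α β ℝ) :
    ridgeInv 0 (s • X) = (s ^ 2)⁻¹ • ridgeInv 0 X := by
  have hs2 : s ^ 2 ≠ 0 := pow_ne_zero 2 hs
  have e : (s • X)ᵀ * (s • X) = s ^ 2 • (Xᵀ * X) := by
    rw [Matrix.transpose_smul, Matrix.smul_mul, Matrix.mul_smul, smul_smul, sq]
  simp only [ridgeInv, zero_smul, add_zero, e]
  by_cases h : IsUnit (Xᵀ * X).det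
  · have := invertibleOfNonzero hs2
    rw [Matrix.inv_smul _ _ h, invOf_eq_inv]
  -- A singular XᵀX has default inverse 0, as does each of its multiples, so homogeneity holds
  -- everywhere and not just almost everywhere.
  · rw [Matrix.nonsing_inv_apply_not_isUnit _ h, Matrix.nonsing_inv_apply_not_isUnit, smul_zero]
    rw [isUnit_iff_ne_zero, not_not] at h ⊢
    rw [Matrix.det_smul, h, mul_zero]

theorem ridgeField_zero_smul (t : ℝ) {s : ℝ} (hs : s ≠ 0) (X : Matrix α β ℝ) :
    ridgeField t 0 (s • X) = s • ridgeField t 0 X := by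
  simp only [ridgeField, ridgeInv_zero_smul hs, Matrix.trace_smul, Matrix.smul_mul,
    Matrix.mul_smul, smul_smul, smul_add, smul_eq_mul]
  congr 2
  · by_cases h : (ridgeInv 0 X).trace = 0
    · simp [h]
    · field_simp
  · by_cases h : (ridgeInv 0 X).trace = 0
    · simp [h]
    · field_simp

theorem ridgePairing_zero_smul (t : ℝ) {s : ℝ} (hs : s ≠ 0) (L X : Matrix α β ℝ) :
    ridgePairing t 0 (s • L) (s • X) = s ^ 2 * ridgePairing t 0 L X := by
  simp only [ridgePairing, ridgeField_zero_smul t hs, Finset.mul_sum, Matrix.smul_apply,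
    smul_eq_mul]
  refine Finset.sum_congr rfl fun i _ => Finset.sum_congr rfl fun j _ => ?_
  ring

theorem ridgePairing_eq_trace (t ε : ℝ) (L X : Matrix α β ℝ) :
    ridgePairing t ε L X = (Lᵀ * ridgeField t ε X).trace := by
  rw [ridgePairing, Finset.sum_comm]
  simp only [Matrix.trace, Matrix.diag, Matrix.mul_apply, Matrix.transpose_apply]

variable {E : Type*} [MeasurableSpace E]

omit [Fintype α] [DecidableEq β] in
theorem measurable_mul_elem {γ : Type*} {A : E → Matrix α β ℝ} {B : E → Matrix β γ ℝ}
    (hA : ∀ i j, Measurable fun w => A w i j) (hB : ∀ i j, Measurable fun w => B w i j) (i : α)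
    (j : γ) : Measurable fun w => (A w * B w) i j := by
  simp only [Matrix.mul_apply]
  exact Finset.measurable_sum _ fun k _ => (hA i k).mul (hB k j)

/-- At ε = 0 the inverse need not be continuous, but det⁻¹ times the adjugate is measurable even
through singular matrices. -/
theorem measurable_ridgePairing (t ε : ℝ) [TopologicalSpace E] [BorelSpace E]
    {L X : E → Matrix α β ℝ} (hL : Continuous L) (hX : Continuous X) :
    Measurable fun w => ridgePairing t ε (L w) (X w) := by
  have hX' : ∀ i j, Measurable fun w => X w i j := fun i j => (hX.matrix_elem i j).measurable
  have hA : Continuous fun w => (X w)ᵀ * X w + ε • (1 : Matrix β β ℝ) :=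
    (hX.matrix_transpose.matrix_mul hX).add continuous_const
  have hR : ∀ i j, Measurable fun w => ridgeInv ε (X w) i j := by
    intro i j
    simp only [ridgeInv, Matrix.inv_def, Ring.inverse_eq_inv', Matrix.smul_apply, smul_eq_mul]
    exact hA.matrix_det.measurable.inv.mul (hA.matrix_adjugate.matrix_elem i j).measurable
  have hT : Measurable fun w => (ridgeInv ε (X w)).trace := Finset.measurable_sum _ fun k _ => hR k k
  have hXR := measurable_mul_elem hX' hR
  have hXRR := measurable_mul_elem hXR hR
  refine Finset.measurable_sum _ fun i _ => Finset.measurable_sum _ fun j _ => ?_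
  refine (hL.matrix_elem i j).measurable.mul (Measurable.add ?_ ?_)
  · exact (measurable_const.div hT).mul (hXR i j)
  · exact (measurable_const.div (hT.pow_const 2)).mul (hXRR i j)

end HomogeneousField

/-! ### The bound for an arbitrary generator. -/

section

open Matrix Filter Topology Module

variable {E : Type*} [NormedAddCommGroup E] [NormedSpace ℝ E] [FiniteDimensional ℝ E]
variable [MeasurableSpace E] [BorelSpace E] (μ : Measure E) [μ.IsAddHaarMeasure]
variable {α β : Type*} [Fintype α] [Fintype β] [DecidableEq α] [DecidableEq β]

theorem lintegral_ofReal_mul_ridgePairing_le [Nonempty β] {Q : E → ℝ} (hQc : Continuous Q)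
    (hQh : ∀ (s : ℝ) (x : E), Q (s • x) = s ^ 2 * Q x) (hQp : ∀ x, x ≠ 0 → 0 < Q x)
    (X L : E →ₗ[ℝ] Matrix α β ℝ)
    {e : α → β → E} (he : ∀ i j, X (e i j) = Matrix.single i j 1)
    (hQd : ∀ x i j, HasLineDerivAt ℝ Q (2 * L x i j) x (e i j))
    {t : ℝ} (ht0 : 0 ≤ t) (hcard : Fintype.card β ≤ Fintype.card α)
    (ht : t * ((Fintype.card α : ℝ) - Fintype.card β + 1) ≤ 2 * ((Fintype.card β : ℝ) - 1))
    (hpos : ∀ w ε, 0 < ε → 0 ≤ ridgePairing t ε (L w) (X w)) {f : ℝ → ℝ} (hf : Measurable f) :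
    ∫⁻ w, ENNReal.ofReal (f (Q w)) * ENNReal.ofReal (ridgePairing t 0 (L w) (X w)) ∂μ ≤
      ENNReal.ofReal (2 * t * Fintype.card α) * ∫⁻ w, FStar f (Q w) ∂μ := by
  have hXc : Continuous X := LinearMap.continuous_of_finiteDimensional X
  have hLc : Continuous L := LinearMap.continuous_of_finiteDimensional L
  refine lintegral_mul_le_of_test μ hQh hQc hQp
    (measurable_ridgePairing t 0 hLc hXc).ennreal_ofReal (fun s x hs => ?_)
    (lintegral_four_mul_max_mul_ridgePairing_le μ hQc (hasCompactSupport_max_one_sub hQc hQh hQp)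
      X he hLc hQd ht0 hcard ht hpos) hf
  rw [map_smul, map_smul, ridgePairing_zero_smul t hs.ne', ENNReal.ofReal_mul (by positivity)]

end

/-! ### The loss difference, and its expression through the field. -/

section PseudoInverse

open Matrix

variable {p : ℕ}

/-- The loss of H is tr(Σ⁻¹ H S⁺ H) - 2 tr(S⁺H) + tr(S⁺Σ). For H = S + g SS⁺ the Penrose equations
give H S⁺ H = S + 2g SS⁺ + g² S⁺ and S⁺H = S⁺S + g S⁺. With g = t / tr S⁺ the linear part becomes
the constant -2at when tr S⁺ ≠ 0. -/
theorem dataLoss_sub_dataLoss {S Sig : Matrix (Fin p) (Fin p) ℝ} (hSig : Sig.det ≠ 0)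
    (hS : Sᵀ = S) (a g : ℝ) :
    dataLoss S Sig (a • (S + g • (S * pinv S))) - dataLoss S Sig (a • S) =
      a ^ 2 * (Sig⁻¹ * ((2 * g) • (S * pinv S) + g ^ 2 • pinv S)).trace -
        2 * (a * (g * (pinv S).trace)) := by
  have hP := pinv_spec S
  have hu : IsUnit Sig.det := hSig.isUnit
  have expand : ∀ H : Matrix (Fin p) (Fin p) ℝ, dataLoss S Sig H =
      (Sig⁻¹ * (H * pinv S * H)).trace - 2 * (pinv S * H).trace + (pinv S * Sig).trace := by
    intro H
    have e : pinv S * Sig * (Sig⁻¹ * H - 1) ^ 2 =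
        pinv S * H * Sig⁻¹ * H - pinv S * H - pinv S * H + pinv S * Sig := by
      have e1 : Sig * (Sig⁻¹ * H - 1) = H - Sig := by
        rw [Matrix.mul_sub, ← Matrix.mul_assoc, Matrix.mul_nonsing_inv _ hu, Matrix.one_mul,
          Matrix.mul_one]
      rw [sq, ← Matrix.mul_assoc, Matrix.mul_assoc (pinv S), e1, Matrix.mul_sub (pinv S * (H - Sig)),
        Matrix.mul_one, Matrix.mul_sub, Matrix.sub_mul, Matrix.mul_assoc (pinv S) Sig,
        ← Matrix.mul_assoc Sig, Matrix.mul_nonsing_inv _ hu, Matrix.one_mul, ← Matrix.mul_assoc]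
      abel
    have e2 : (pinv S * H * Sig⁻¹ * H).trace = (Sig⁻¹ * (H * pinv S * H)).trace := by
      rw [Matrix.mul_assoc, Matrix.trace_mul_comm]
      simp only [Matrix.mul_assoc]
    rw [dataLoss, e, Matrix.trace_add, Matrix.trace_sub, Matrix.trace_sub, e2]
    ring
  have hc : pinv S * S = S * pinv S := by
    have := hP.symm_left
    rwa [Matrix.transpose_mul, hS, hP.transpose_eq hS] at this
  have e3 : (S + g • (S * pinv S)) * pinv S * (S + g • (S * pinv S)) =
      S + ((2 * g) • (S * pinv S) + g ^ 2 • pinv S) := by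
    have h1 : (S + g • (S * pinv S)) * pinv S = S * pinv S + g • pinv S := by
      rw [Matrix.add_mul, Matrix.smul_mul, ← hc, hP.mul_mul_right]
    rw [h1, Matrix.add_mul, Matrix.mul_add, Matrix.mul_add, hP.mul_mul_left, Matrix.mul_smul,
      ← Matrix.mul_assoc, hP.mul_mul_left, Matrix.smul_mul, Matrix.smul_mul, Matrix.mul_smul,
      ← Matrix.mul_assoc, hP.mul_mul_right, hc, smul_smul]
    module
  have e4 : pinv S * (S + g • (S * pinv S)) = pinv S * S + g • pinv S := by
    rw [Matrix.mul_add, Matrix.mul_smul, ← Matrix.mul_assoc, hP.mul_mul_right]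
  have hsmul : ∀ M : Matrix (Fin p) (Fin p) ℝ, dataLoss S Sig (a • M) =
      a ^ 2 * (Sig⁻¹ * (M * pinv S * M)).trace - 2 * (a * (pinv S * M).trace) +
        (pinv S * Sig).trace := by
    intro M
    rw [expand]
    simp only [Matrix.smul_mul, Matrix.mul_smul, smul_smul, Matrix.trace_smul, smul_eq_mul, sq]
  rw [hsmul, hsmul, e3, e4, hP.mul_mul_left, Matrix.mul_add Sig⁻¹, Matrix.trace_add,
    Matrix.trace_add, Matrix.trace_smul, smul_eq_mul]
  ring

theorem pinv_eq_of_isMoorePenrose {A X : Matrix (Fin p) (Fin p) ℝ} (h : IsMoorePenrose A X) :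
    pinv A = X :=
  (pinv_spec A).unique h

theorem pinv_eq_inv {A : Matrix (Fin p) (Fin p) ℝ} (h : A.det ≠ 0) : pinv A = A⁻¹ := by
  have hu := h.isUnit
  refine pinv_eq_of_isMoorePenrose ⟨?_, ?_, ?_, ?_⟩ <;>
    simp [Matrix.mul_nonsing_inv _ hu, Matrix.nonsing_inv_mul _ hu]

theorem pinv_mul_transpose {m : ℕ} {X : Matrix (Fin p) (Fin m) ℝ} (h : (Xᵀ * X).det ≠ 0) :
    pinv (X * Xᵀ) = X * (Xᵀ * X)⁻¹ * (Xᵀ * X)⁻¹ * Xᵀ := by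
  have hu := h.isUnit
  have hT : ((Xᵀ * X)⁻¹)ᵀ = (Xᵀ * X)⁻¹ := by simp [Matrix.transpose_nonsing_inv]
  have h1 : Xᵀ * X * (Xᵀ * X)⁻¹ = 1 := Matrix.mul_nonsing_inv _ hu
  have h2 : (Xᵀ * X)⁻¹ * (Xᵀ * X) = 1 := Matrix.nonsing_inv_mul _ hu
  set R := (Xᵀ * X)⁻¹
  have e1 : X * Xᵀ * (X * R * R * Xᵀ) = X * R * Xᵀ := by
    calc _ = X * ((Xᵀ * X) * R) * (R * Xᵀ) := by simp only [Matrix.mul_assoc]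
      _ = _ := by rw [h1, Matrix.mul_one, Matrix.mul_assoc]
  have e2 : X * R * R * Xᵀ * (X * Xᵀ) = X * R * Xᵀ := by
    calc _ = X * R * (R * (Xᵀ * X)) * Xᵀ := by simp only [Matrix.mul_assoc]
      _ = _ := by rw [h2, Matrix.mul_one]
  have e3 : (X * R * Xᵀ)ᵀ = X * R * Xᵀ := by
    simp [Matrix.transpose_mul, hT, Matrix.mul_assoc]
  refine pinv_eq_of_isMoorePenrose ⟨?_, ?_, ?_, ?_⟩
  · rw [e1]
    calc _ = X * (R * (Xᵀ * X)) * Xᵀ := by simp only [Matrix.mul_assoc]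
      _ = _ := by rw [h2, Matrix.mul_one]
  · rw [e2]
    calc _ = X * (R * (Xᵀ * X)) * R * R * Xᵀ := by simp only [Matrix.mul_assoc]
      _ = _ := by rw [h2, Matrix.mul_one]
  · rw [e1, e3]
  · rw [e2, e3]

/-- `tr (Σ⁻¹ (2 g S S⁺ + g² S⁺))` with `g = t / tr S⁺`. -/
noncomputable def shrinkGain (t : ℝ) (Sig S : Matrix (Fin p) (Fin p) ℝ) : ℝ :=
  (Sig⁻¹ * ((2 * (t / (pinv S).trace)) • (S * pinv S) +
    (t / (pinv S).trace) ^ 2 • pinv S)).trace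

theorem shrinkGain_nonneg {t : ℝ} (ht : 0 ≤ t) {Sig S : Matrix (Fin p) (Fin p) ℝ}
    (hSig : Sig.PosDef) (hS : S.PosSemidef) : 0 ≤ shrinkGain t Sig S := by
  have hST : Sᵀ = S := by simpa [Matrix.IsHermitian] using hS.isHermitian
  have hP := pinv_spec S
  have hPT : (pinv S)ᵀ = pinv S := hP.transpose_eq hST
  have h1 : (pinv S).PosSemidef := by
    have := hS.conjTranspose_mul_mul_same (pinv S)
    rwa [Matrix.conjTranspose_eq_transpose_of_trivial, hPT, hP.mul_mul_right] at this
  have h2 : (S * pinv S).PosSemidef := by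
    have := posSemidef_transpose_mul_self (S * pinv S)
    rwa [hP.symm_left, ← Matrix.mul_assoc, hP.mul_mul_left] at this
  have h3 := h1.trace_nonneg
  refine hSig.inv.posSemidef.trace_mul_nonneg ((h2.smul ?_).add (h1.smul ?_)) <;> positivity

theorem trace_pinv_transpose_mul_self_pos {m : ℕ} [Nonempty (Fin p)] {X : Matrix (Fin m) (Fin p) ℝ}
    (h : (Xᵀ * X).det ≠ 0) : 0 < (pinv (Xᵀ * X)).trace := by
  rw [pinv_eq_inv h]
  exact ((posSemidef_transpose_mul_self X).posDef_iff_det_ne_zero.2 h).inv.trace_pos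

theorem trace_pinv_mul_transpose_self {m : ℕ} {X : Matrix (Fin p) (Fin m) ℝ}
    (h : (Xᵀ * X).det ≠ 0) : (pinv (X * Xᵀ)).trace = (Xᵀ * X)⁻¹.trace := by
  rw [pinv_mul_transpose h, Matrix.trace_mul_comm, ← Matrix.mul_assoc, ← Matrix.mul_assoc,
    Matrix.mul_nonsing_inv _ h.isUnit, Matrix.one_mul]

theorem shrinkGain_transpose_mul_self {m : ℕ} {X : Matrix (Fin m) (Fin p) ℝ}
    (h : (Xᵀ * X).det ≠ 0) {Sig : Matrix (Fin p) (Fin p) ℝ} (hSig : Sig.PosDef) (t : ℝ) :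
    shrinkGain t Sig (Xᵀ * X) = ridgePairing t 0 (X * Sig⁻¹) X := by
  have hT : (Sig⁻¹)ᵀ = Sig⁻¹ := by simpa [Matrix.IsHermitian] using hSig.inv.isHermitian
  rw [ridgePairing_eq_trace, shrinkGain, pinv_eq_inv h, Matrix.transpose_mul, hT,
    Matrix.mul_assoc Sig⁻¹ Xᵀ]
  have e : ridgeInv 0 X = (Xᵀ * X)⁻¹ := by simp [ridgeInv]
  congr 2
  rw [ridgeField, e, Matrix.mul_add, Matrix.mul_smul, Matrix.mul_smul, Matrix.mul_assoc X,
    ← Matrix.mul_assoc Xᵀ, ← Matrix.mul_assoc Xᵀ X (_ * _), ← Matrix.mul_assoc (Xᵀ * X),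
    Matrix.mul_nonsing_inv _ h.isUnit, Matrix.one_mul, div_pow, mul_div_assoc]

/-- With R = (XᵀX)⁻¹, here SS⁺ = X R Xᵀ, S⁺ = X R² Xᵀ and tr S⁺ = tr R. Cycling Xᵀ to the front of
the trace produces the same field as in the invertible case. -/
theorem shrinkGain_mul_transpose_self {m : ℕ} {X : Matrix (Fin p) (Fin m) ℝ}
    (h : (Xᵀ * X).det ≠ 0) {Sig : Matrix (Fin p) (Fin p) ℝ} (hSig : Sig.PosDef) (t : ℝ) :
    shrinkGain t Sig (X * Xᵀ) = ridgePairing t 0 (Sig⁻¹ * X) X := by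
  have hT : (Sig⁻¹)ᵀ = Sig⁻¹ := by simpa [Matrix.IsHermitian] using hSig.inv.isHermitian
  have e : ridgeInv 0 X = (Xᵀ * X)⁻¹ := by simp [ridgeInv]
  have h1 : X * Xᵀ * (X * (Xᵀ * X)⁻¹ * (Xᵀ * X)⁻¹ * Xᵀ) = X * (Xᵀ * X)⁻¹ * Xᵀ := by
    calc _ = X * ((Xᵀ * X) * (Xᵀ * X)⁻¹) * ((Xᵀ * X)⁻¹ * Xᵀ) := by simp only [Matrix.mul_assoc]
      _ = _ := by rw [Matrix.mul_nonsing_inv _ h.isUnit, Matrix.mul_one, Matrix.mul_assoc]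
  rw [ridgePairing_eq_trace, shrinkGain, trace_pinv_mul_transpose_self h, pinv_mul_transpose h, h1,
    Matrix.transpose_mul, hT, Matrix.mul_assoc Xᵀ Sig⁻¹, Matrix.trace_mul_comm Xᵀ,
    Matrix.mul_assoc Sig⁻¹]
  congr 2
  rw [ridgeField, e, Matrix.add_mul, Matrix.smul_mul, Matrix.smul_mul, div_pow, mul_div_assoc]

/-- The pairing is the trace of A against a nonnegative combination of XᵀXR and XᵀXR², both positive
semidefinite because R commutes with XᵀX. -/
theorem ridgePairing_mul_right_nonneg {m : ℕ} {t ε : ℝ} (ht : 0 ≤ t) (hε : 0 < ε)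
    (X : Matrix (Fin m) (Fin p) ℝ) {A : Matrix (Fin p) (Fin p) ℝ} (hA : A.PosDef) :
    0 ≤ ridgePairing t ε (X * A) X := by
  have hT : Aᵀ = A := by simpa [Matrix.IsHermitian] using hA.isHermitian
  have hR := posDef_ridgeInv hε X
  have hRt := transpose_ridgeInv ε X
  have hAR := mul_ridgeInv hε X
  have hRA := ridgeInv_mul hε X
  have h0 := hR.posSemidef.trace_nonneg
  rw [ridgePairing_eq_trace, ridgeField, Matrix.transpose_mul, hT]
  set R := ridgeInv ε X
  have p1 : (Xᵀ * X * R * R).PosSemidef := by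
    have := posSemidef_transpose_mul_self (X * R)
    rw [Matrix.transpose_mul, hRt] at this
    have e : R * Xᵀ * (X * R) = Xᵀ * X * R * R := by
      rw [hAR, ← hRA]; simp only [Matrix.mul_assoc]
    rwa [e] at this
  have p2 : (Xᵀ * X * R).PosSemidef := by
    have q1 := posSemidef_transpose_mul_self (Xᵀ * X * R)
    -- With P = XᵀXR = 1 - εR, this is P = P² + P(1 - P), a sum of two positive semidefinite terms.
    have e : Xᵀ * X * R = (Xᵀ * X * R)ᵀ * (Xᵀ * X * R) + ε • (Xᵀ * X * R * R) := by
      have : (Xᵀ * X * R)ᵀ = 1 - ε • R := by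
        rw [hAR, Matrix.transpose_sub, Matrix.transpose_smul, hRt, Matrix.transpose_one]
      rw [this, hAR]
      simp only [Matrix.sub_mul, Matrix.mul_sub, Matrix.one_mul, Matrix.mul_one, Matrix.smul_mul,
        Matrix.mul_smul, smul_sub]
      abel
    rw [e]
    exact q1.add (p1.smul hε.le)
  have e : A * Xᵀ * ((2 * t / R.trace) • (X * R) + (t ^ 2 / R.trace ^ 2) • (X * R * R)) =
      A * ((2 * t / R.trace) • (Xᵀ * X * R) + (t ^ 2 / R.trace ^ 2) • (Xᵀ * X * R * R)) := by
    simp only [Matrix.mul_add, Matrix.mul_smul, Matrix.mul_assoc]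
  rw [e]
  refine hA.posSemidef.trace_mul_nonneg ((p2.smul ?_).add (p1.smul ?_)) <;> positivity

theorem ridgePairing_mul_left_nonneg {m : ℕ} {t ε : ℝ} (ht : 0 ≤ t) (hε : 0 < ε)
    (X : Matrix (Fin p) (Fin m) ℝ) {A : Matrix (Fin p) (Fin p) ℝ} (hA : A.PosDef) :
    0 ≤ ridgePairing t ε (A * X) X := by
  have hT : Aᵀ = A := by simpa [Matrix.IsHermitian] using hA.isHermitian
  have hR := (posDef_ridgeInv hε X).posSemidef
  have hRt := transpose_ridgeInv ε X
  have h0 := hR.trace_nonneg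
  rw [ridgePairing_eq_trace, ridgeField, Matrix.transpose_mul, hT]
  set R := ridgeInv ε X
  have p1 : (R * R).PosSemidef := by
    simpa [hRt] using posSemidef_transpose_mul_self R
  have p0 : (Xᵀ * A * X).PosSemidef := by
    have := hA.posSemidef.conjTranspose_mul_mul_same X
    rwa [Matrix.conjTranspose_eq_transpose_of_trivial] at this
  have e : Xᵀ * A * ((2 * t / R.trace) • (X * R) + (t ^ 2 / R.trace ^ 2) • (X * R * R)) =
      Xᵀ * A * X * ((2 * t / R.trace) • R + (t ^ 2 / R.trace ^ 2) • (R * R)) := by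
    simp only [Matrix.mul_add, Matrix.mul_smul, Matrix.mul_assoc]
  rw [e]
  refine p0.trace_mul_nonneg ((hR.smul ?_).add (p1.smul ?_)) <;> positivity

end PseudoInverse

/-! ### Comparing possibly infinite risks. -/

section Comparison

/-- Integrate u + (u-v)⁻ = v + (u-v)⁺ and cancel the negative part, whose integral is finite even
when those of u and v are not. -/
theorem lintegral_ofReal_le_of_integral_sub_nonpos {α : Type*} [MeasurableSpace α] {μ : Measure α}
    {u v : α → ℝ} (hu : ∀ x, 0 ≤ u x) (hv : ∀ x, 0 ≤ v x) (hd : Integrable (fun x => u x - v x) μ)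
    (h : ∫ x, (u x - v x) ∂μ ≤ 0) :
    ∫⁻ x, ENNReal.ofReal (u x) ∂μ ≤ ∫⁻ x, ENNReal.ofReal (v x) ∂μ := by
  have hm := hd.aestronglyMeasurable.aemeasurable
  have hp : ∫⁻ x, ENNReal.ofReal (u x - v x) ∂μ ≠ ∞ := hd.lintegral_lt_top.ne
  have hn : ∫⁻ x, ENNReal.ofReal (-(u x - v x)) ∂μ ≠ ∞ := hd.neg.lintegral_lt_top.ne
  rw [integral_eq_lintegral_pos_part_sub_lintegral_neg_part hd, sub_nonpos,
    ENNReal.toReal_le_toReal hp hn] at h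
  have key : ∫⁻ x, ENNReal.ofReal (u x) ∂μ + ∫⁻ x, ENNReal.ofReal (-(u x - v x)) ∂μ =
      ∫⁻ x, ENNReal.ofReal (v x) ∂μ + ∫⁻ x, ENNReal.ofReal (u x - v x) ∂μ := by
    rw [← lintegral_add_right' _ (show AEMeasurable (fun x => ENNReal.ofReal (-(u x - v x))) μ from
      hm.neg.ennreal_ofReal), ← lintegral_add_right' _ hm.ennreal_ofReal]
    refine lintegral_congr fun x => ?_
    rcases le_total (u x) (v x) with hx | hx
    · rw [ENNReal.ofReal_of_nonpos (sub_nonpos.2 hx), add_zero,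
        ← ENNReal.ofReal_add (hu x) (by linarith)]
      congr 1; ring
    · rw [ENNReal.ofReal_of_nonpos (by linarith : -(u x - v x) ≤ 0), add_zero,
        ← ENNReal.ofReal_add (hv x) (by linarith)]
      congr 1; ring
  refine (ENNReal.add_le_add_iff_right hn).1 ?_
  rw [key]
  gcongr

end Comparison

/-! ### Application to the elliptic form on the observation space. -/

section EllipticArg

open Matrix Filter Topology Module

variable {q m p : ℕ}

theorem isAddHaarMeasure_volume_obs : (volume : Measure (Obs q m p)).IsAddHaarMeasure := by
  have hpi : ∀ k : ℕ, (volume : Measure (Fin k → Fin p → ℝ)).IsAddHaarMeasure := fun k =>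
    Measure.pi.isAddHaarMeasure (fun _ : Fin k => (volume : Measure (Fin p → ℝ)))
  have hq := hpi q
  have hm := hpi m
  rw [Measure.volume_eq_prod]
  infer_instance

theorem trace_mul_mul_transpose_eq_sum {k : ℕ} (A : Matrix (Fin p) (Fin p) ℝ)
    (w : Matrix (Fin k) (Fin p) ℝ) :
    (w * A * wᵀ).trace = ∑ i, w i ⬝ᵥ (A *ᵥ w i) := by
  simp only [Matrix.trace, Matrix.diag]
  refine Finset.sum_congr rfl fun i _ => ?_
  rw [Matrix.mul_assoc, Matrix.mul_apply_eq_vecMul]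
  simp only [Matrix.vecMul, dotProduct, Matrix.mul_apply, Matrix.mulVec, Matrix.transpose_apply]

theorem ellipticArg_zero_eq_sum (Sig : Matrix (Fin p) (Fin p) ℝ) (x : Obs q m p) :
    ellipticArg 0 Sig x = ∑ i, x.1 i ⬝ᵥ (Sig⁻¹ *ᵥ x.1 i) + ∑ i, x.2 i ⬝ᵥ (Sig⁻¹ *ᵥ x.2 i) := by
  rw [ellipticArg, sub_zero, trace_mul_mul_transpose_eq_sum, Matrix.trace_mul_comm,
    Matrix.mul_assoc, Matrix.trace_mul_comm, trace_mul_mul_transpose_eq_sum]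
  rfl

theorem continuous_ellipticArg (θ : Matrix (Fin q) (Fin p) ℝ) (Sig : Matrix (Fin p) (Fin p) ℝ) :
    Continuous fun x : Obs q m p => ellipticArg θ Sig x := by
  have h1 : Continuous fun x : Obs q m p => Matrix.of x.1 - θ :=
    (show Continuous fun x : Obs q m p => (Matrix.of x.1 : Matrix _ _ ℝ) from
      continuous_fst).sub continuous_const
  have h2 : Continuous fun x : Obs q m p => (Matrix.of x.2 : Matrix _ _ ℝ) := continuous_snd
  exact ((h1.matrix_mul continuous_const).matrix_mul h1.matrix_transpose).matrix_trace.add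
    (continuous_const.matrix_mul (h2.matrix_transpose.matrix_mul h2)).matrix_trace

theorem ellipticArg_zero_smul (Sig : Matrix (Fin p) (Fin p) ℝ) (s : ℝ) (x : Obs q m p) :
    ellipticArg 0 Sig (s • x) = s ^ 2 * ellipticArg 0 Sig x := by
  simp only [ellipticArg_zero_eq_sum, Prod.smul_fst, Prod.smul_snd, Pi.smul_apply,
    Matrix.mulVec_smul, dotProduct_smul, smul_dotProduct, smul_eq_mul, mul_add, Finset.mul_sum, sq,
    mul_assoc]

theorem ellipticArg_zero_pos {Sig : Matrix (Fin p) (Fin p) ℝ} (hSig : Sig.PosDef)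
    {x : Obs q m p} (hx : x ≠ 0) : 0 < ellipticArg 0 Sig x := by
  have h0 : ∀ v : Fin p → ℝ, 0 ≤ v ⬝ᵥ (Sig⁻¹ *ᵥ v) := fun v => by
    simpa using hSig.inv.posSemidef.dotProduct_mulVec_nonneg v
  have hpos : ∀ v : Fin p → ℝ, v ≠ 0 → 0 < v ⬝ᵥ (Sig⁻¹ *ᵥ v) := fun v hv => by
    simpa using hSig.inv.dotProduct_mulVec_pos hv
  have hrow : ∀ {k : ℕ} (w : Fin k → Fin p → ℝ), w ≠ 0 → 0 < ∑ i, w i ⬝ᵥ (Sig⁻¹ *ᵥ w i) := by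
    intro k w hw
    obtain ⟨i, hi⟩ := Function.ne_iff.1 hw
    exact Finset.sum_pos' (fun i _ => h0 _) ⟨i, Finset.mem_univ _, hpos _ hi⟩
  have hn : ∀ {k : ℕ} (w : Fin k → Fin p → ℝ), 0 ≤ ∑ i, w i ⬝ᵥ (Sig⁻¹ *ᵥ w i) := fun w =>
    Finset.sum_nonneg fun i _ => h0 _
  rw [ellipticArg_zero_eq_sum]
  by_cases h1 : x.1 = 0
  · have h2 : x.2 ≠ 0 := fun h2 => hx (Prod.ext h1 h2)
    exact add_pos_of_nonneg_of_pos (hn _) (hrow _ h2)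
  · exact add_pos_of_pos_of_nonneg (hrow _ h1) (hn _)

theorem hasLineDerivAt_ellipticArg_zero {Sig : Matrix (Fin p) (Fin p) ℝ} (hSig : Sig.PosDef)
    (x : Obs q m p) (i : Fin m) (j : Fin p) :
    HasLineDerivAt ℝ (fun x : Obs q m p => ellipticArg 0 Sig x)
      (2 * (Matrix.of x.2 * Sig⁻¹) i j) x (0, Matrix.single i j (1 : ℝ)) := by
  have hT : (Sig⁻¹)ᵀ = Sig⁻¹ := by simpa [Matrix.IsHermitian] using hSig.inv.isHermitian
  have hU := hasEntryDeriv_add_smul (Matrix.of x.2) (Matrix.single i j (1 : ℝ))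
  have hC : HasEntryDeriv (fun _ : ℝ => Sig⁻¹) 0 := fun _ _ => hasDerivAt_const _ _
  have hD := ((hC.mul (hU.transpose.mul hU)).trace).const_add
    ((Matrix.of x.1 - (0 : Matrix (Fin q) (Fin p) ℝ)) * Sig⁻¹ * (Matrix.of x.1 - 0)ᵀ).trace
  have hX0 : Matrix.of x.2 + (0 : ℝ) • Matrix.single i j (1 : ℝ) = Matrix.of x.2 := by simp
  refine (hD.congr_deriv ?_).congr_of_eventuallyEq (Eventually.of_forall fun s => ?_)
  · rw [Matrix.zero_mul, zero_add, hX0, Matrix.mul_add, Matrix.trace_add, two_mul]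
    have g2 : (Sig⁻¹ * ((Matrix.of x.2)ᵀ * Matrix.single i j (1 : ℝ))).trace =
        (Matrix.of x.2 * Sig⁻¹) i j := by
      have : (Matrix.of x.2 * Sig⁻¹) i j = ((Matrix.of x.2 * Sig⁻¹)ᵀ) j i := rfl
      rw [this, Matrix.transpose_mul, hT, ← Matrix.mul_assoc]
      simp [Matrix.trace, Matrix.mul_apply, Matrix.single_apply, ite_and]
    have g1 : (Sig⁻¹ * ((Matrix.single i j (1 : ℝ))ᵀ * Matrix.of x.2)).trace =
        (Sig⁻¹ * ((Matrix.of x.2)ᵀ * Matrix.single i j (1 : ℝ))).trace := by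
      rw [← Matrix.trace_transpose, Matrix.transpose_mul, Matrix.transpose_mul,
        Matrix.transpose_transpose, hT, Matrix.trace_mul_comm]
    rw [g1, g2]
  · simp only [ellipticArg]
    have e1 : (x + s • ((0, Matrix.single i j (1 : ℝ)) : Obs q m p)).1 = x.1 := by simp
    rw [e1]
    rfl

/-- The matrix `u` of an observation `(z, u)`, as a linear map. -/
def residualMap (q m p : ℕ) : Obs q m p →ₗ[ℝ] Matrix (Fin m) (Fin p) ℝ :=
  (Matrix.ofLinearEquiv ℝ).toLinearMap ∘ₗ LinearMap.snd ℝ _ _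

theorem residualMap_apply (x : Obs q m p) : residualMap q m p x = Matrix.of x.2 := rfl

/-- `G` is a measurable substitute for the gain, which is built from a chosen pseudo-inverse. The
cases p ≤ m and m ≤ p differ only in taking X = u or X = uᵀ, so that X always has full column rank
almost everywhere. -/
theorem exists_measurable_ae_eq_shrinkGain {Sig : Matrix (Fin p) (Fin p) ℝ} (hSig : Sig.PosDef)
    {t : ℝ} (ht0 : 0 ≤ t) (hmin : 1 ≤ min p m)
    (ht : t * (((max p m : ℕ) : ℝ) - ((min p m : ℕ) : ℝ) + 1) ≤ 2 * (((min p m : ℕ) : ℝ) - 1)) :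
    ∃ G : (Fin m → Fin p → ℝ) → ℝ, Measurable G ∧
      (∀ᵐ x : Obs q m p, 0 < (pinv (gram x.2)).trace ∧ shrinkGain t Sig (gram x.2) = G x.2) ∧
      ∀ f : ℝ → ℝ, Measurable f →
        ∫⁻ x : Obs q m p, ENNReal.ofReal (f (ellipticArg 0 Sig x)) * ENNReal.ofReal (G x.2) ≤
          ENNReal.ofReal (2 * t * (max p m : ℕ)) *
            ∫⁻ x : Obs q m p, FStar f (ellipticArg 0 Sig x) := by
  have hvol := isAddHaarMeasure_volume_obs (q := q) (m := m) (p := p)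
  have hp1 : 1 ≤ p := hmin.trans (min_le_left _ _)
  have hm1 : 1 ≤ m := hmin.trans (min_le_right _ _)
  have hnp : Nonempty (Fin p) := ⟨⟨0, hp1⟩⟩
  have hnm : Nonempty (Fin m) := ⟨⟨0, hm1⟩⟩
  have hc : Continuous fun u : Fin m → Fin p → ℝ => (Matrix.of u : Matrix _ _ ℝ) := continuous_id
  have hsurj : Function.Surjective (residualMap q m p) := fun Y => ⟨(0, Y), rfl⟩
  rcases le_total p m with hpm | hpm
  · rw [max_eq_right hpm, min_eq_left hpm] at ht
    rw [max_eq_right hpm]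
    refine ⟨fun u => ridgePairing t 0 (Matrix.of u * Sig⁻¹) (Matrix.of u),
      measurable_ridgePairing t 0 (hc.matrix_mul continuous_const) hc, ?_, fun f hf => ?_⟩
    · filter_upwards [ae_det_transpose_mul_self_ne_zero volume (residualMap q m p) hsurj
        (by simpa using hpm)] with x hx
      rw [residualMap_apply] at hx
      exact ⟨trace_pinv_transpose_mul_self_pos hx, shrinkGain_transpose_mul_self hx hSig t⟩
    · have := lintegral_ofReal_mul_ridgePairing_le (volume : Measure (Obs q m p))
        (continuous_ellipticArg 0 Sig) (ellipticArg_zero_smul Sig)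
        (fun x hx => ellipticArg_zero_pos hSig hx) (residualMap q m p)
        (mulRightLinearMap (Fin m) ℝ Sig⁻¹ ∘ₗ residualMap q m p)
        (e := fun i j => (0, Matrix.single i j (1 : ℝ))) (fun i j => rfl)
        (fun x i j => hasLineDerivAt_ellipticArg_zero hSig x i j) ht0 (by simpa using hpm)
        (by simpa using ht) (fun w ε hε =>
          ridgePairing_mul_right_nonneg ht0 hε (Matrix.of w.2) hSig.inv) hf
      rw [Fintype.card_fin] at this
      exact this
  · rw [max_eq_left hpm, min_eq_right hpm] at ht
    rw [max_eq_left hpm]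
    let X : Obs q m p →ₗ[ℝ] Matrix (Fin p) (Fin m) ℝ :=
      (Matrix.transposeLinearEquiv (Fin m) (Fin p) ℝ ℝ).toLinearMap ∘ₗ residualMap q m p
    have hXs : Function.Surjective X := fun Y => ⟨(0, Yᵀ), rfl⟩
    refine ⟨fun u => ridgePairing t 0 (Sig⁻¹ * (Matrix.of u)ᵀ) (Matrix.of u)ᵀ,
      measurable_ridgePairing t 0 (continuous_const.matrix_mul hc.matrix_transpose)
        hc.matrix_transpose, ?_, fun f hf => ?_⟩
    · filter_upwards [ae_det_transpose_mul_self_ne_zero volume X hXs (by simpa using hpm)] with x hx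
      have hX : X x = (Matrix.of x.2)ᵀ := rfl
      rw [hX] at hx
      have hg : gram x.2 = (Matrix.of x.2)ᵀ * (Matrix.of x.2)ᵀᵀ := rfl
      rw [hg]
      refine ⟨?_, shrinkGain_mul_transpose_self hx hSig t⟩
      rw [trace_pinv_mul_transpose_self hx]
      exact ((posSemidef_transpose_mul_self _).posDef_iff_det_ne_zero.2 hx).inv.trace_pos
    · have hT : (Sig⁻¹)ᵀ = Sig⁻¹ := by simpa [Matrix.IsHermitian] using hSig.inv.isHermitian
      have he : ∀ i j, X (0, Matrix.single j i (1 : ℝ)) = Matrix.single i j (1 : ℝ) := fun i j =>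
        Matrix.transpose_single j i 1
      have hd : ∀ (x : Obs q m p) i j, HasLineDerivAt ℝ (fun x : Obs q m p => ellipticArg 0 Sig x)
          (2 * (Sig⁻¹ * (Matrix.of x.2)ᵀ) i j) x (0, Matrix.single j i (1 : ℝ)) := by
        intro x i j
        have e : (Sig⁻¹ * (Matrix.of x.2)ᵀ) i j = (Matrix.of x.2 * Sig⁻¹) j i := by
          rw [← Matrix.transpose_apply (Matrix.of x.2 * Sig⁻¹), Matrix.transpose_mul, hT]
        rw [e]
        exact hasLineDerivAt_ellipticArg_zero hSig x j i
      have := lintegral_ofReal_mul_ridgePairing_le (volume : Measure (Obs q m p))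
        (continuous_ellipticArg 0 Sig) (ellipticArg_zero_smul Sig)
        (fun x hx => ellipticArg_zero_pos hSig hx) X (mulLeftLinearMap (Fin m) ℝ Sig⁻¹ ∘ₗ X)
        (e := fun i j => (0, Matrix.single j i (1 : ℝ)))
        he hd ht0 (by simpa using hpm)
        (by simpa using ht) (fun w ε hε =>
          ridgePairing_mul_left_nonneg ht0 hε (Matrix.of w.2)ᵀ hSig.inv) hf
      rw [Fintype.card_fin] at this
      exact this

/-- `G` depends on u alone, so translating z removes θ; the determinant factor is common to both
sides. -/
theorem lintegral_canonicalLaw_le {f : ℝ → ℝ} (hf : Measurable f) (θ : Matrix (Fin q) (Fin p) ℝ)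
    {Sig : Matrix (Fin p) (Fin p) ℝ} (hSig : Sig.PosDef) {G : (Fin m → Fin p → ℝ) → ℝ≥0∞}
    (hG : Measurable G) {M : ℝ≥0∞}
    (h : ∫⁻ x : Obs q m p, ENNReal.ofReal (f (ellipticArg 0 Sig x)) * G x.2 ≤
      M * ∫⁻ x : Obs q m p, FStar f (ellipticArg 0 Sig x)) :
    ∫⁻ x, G x.2 ∂(canonicalLaw m f θ Sig) ≤ M * kStar q m p f := by
  have hvol := isAddHaarMeasure_volume_obs (q := q) (m := m) (p := p)
  have hdm : Measurable (ellipticDensity (m := m) (fun v => ENNReal.ofReal (f v)) θ Sig) :=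
    (hf.ennreal_ofReal.comp (continuous_ellipticArg θ Sig).measurable).const_mul _
  have harg : ∀ x : Obs q m p, ellipticArg θ Sig (x + ((fun i j => θ i j), 0)) = ellipticArg 0 Sig x := by
    intro x
    have e1 : Matrix.of (x + (((fun i j => θ i j), 0) : Obs q m p)).1 - θ = Matrix.of x.1 - 0 := by
      ext i j; simp
    have e2 : (x + (((fun i j => θ i j), 0) : Obs q m p)).2 = x.2 := by simp
    rw [ellipticArg, ellipticArg, e1, e2]
  have hk : kStar q m p f = ENNReal.ofReal (Sig.det ^ (-((q + m : ℕ) : ℝ) / 2)) *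
      ∫⁻ x : Obs q m p, FStar f (ellipticArg 0 Sig x) := by
    rw [kStar, ← lintegral_ellipticDensity_eq (FStar f) 0 hSig]
    simp only [ellipticDensity]
    rw [lintegral_const_mul' _ _ ENNReal.ofReal_ne_top]
  rw [canonicalLaw, lintegral_withDensity_eq_lintegral_mul _ hdm
    (show Measurable fun x : Obs q m p => G x.2 from hG.comp measurable_snd), hk]
  calc _ = ∫⁻ x : Obs q m p, ENNReal.ofReal (Sig.det ^ (-((q + m : ℕ) : ℝ) / 2)) *
        (ENNReal.ofReal (f (ellipticArg θ Sig x)) * G x.2) :=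
        lintegral_congr fun x => mul_assoc _ _ _
    _ = ENNReal.ofReal (Sig.det ^ (-((q + m : ℕ) : ℝ) / 2)) *
        ∫⁻ x : Obs q m p, ENNReal.ofReal (f (ellipticArg θ Sig x)) * G x.2 :=
        lintegral_const_mul' _ _ ENNReal.ofReal_ne_top
    _ = ENNReal.ofReal (Sig.det ^ (-((q + m : ℕ) : ℝ) / 2)) *
        ∫⁻ x : Obs q m p, ENNReal.ofReal (f (ellipticArg 0 Sig x)) * G x.2 := by
        rw [← lintegral_add_right_eq_self (fun x : Obs q m p =>
          ENNReal.ofReal (f (ellipticArg θ Sig x)) * G x.2) ((fun i j => θ i j), 0)]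
        simp only [harg, Prod.snd_add, add_zero]
    _ ≤ ENNReal.ofReal (Sig.det ^ (-((q + m : ℕ) : ℝ) / 2)) *
        (M * ∫⁻ x : Obs q m p, FStar f (ellipticArg 0 Sig x)) := by gcongr
    _ = _ := by ring

end EllipticArg

/-! ### The domination result. -/

theorem mainTheorem1 (q m p : ℕ) (f : ℝ → ℝ) (hf : Measurable f)
    (hf_nonneg : ∀ v, 0 ≤ v → 0 ≤ f v)
    (hK : kStar q m p f ≠ ∞)
    (θ : Matrix (Fin q) (Fin p) ℝ) (Sig : Matrix (Fin p) (Fin p) ℝ) (hSig : Sig.PosDef)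
    (hprob : IsProbabilityMeasure (canonicalLaw m f θ Sig))
    (t : ℝ) (ht0 : 0 ≤ t)
    (ht : t ≤ 2 * (((min p m : ℕ) : ℝ) - 1) /
      (((max p m : ℕ) : ℝ) - ((min p m : ℕ) : ℝ) + 1)) :
    dataRisk f θ Sig (konnoEst q m p f t) ≤ dataRisk f θ Sig (usualEst q m p f) ∧
    Integrable (fun x => dataLoss (gram x.2) Sig (konnoEst q m p f t x) -
      dataLoss (gram x.2) Sig (usualEst q m p f x)) (canonicalLaw m f θ Sig) ∧
    ∫ x, (dataLoss (gram x.2) Sig (konnoEst q m p f t x) -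
      dataLoss (gram x.2) Sig (usualEst q m p f x)) ∂(canonicalLaw m f θ Sig) ≤ 0 := by
  have hd : (0 : ℝ) < ((max p m : ℕ) : ℝ) - ((min p m : ℕ) : ℝ) + 1 := by
    have : ((min p m : ℕ) : ℝ) ≤ ((max p m : ℕ) : ℝ) := by exact_mod_cast min_le_max
    linarith
  have ht' := (le_div_iff₀ hd).1 ht
  -- If p ∧ m were 0 the upper bound on t would be negative, so nonemptiness of both index sets is
  -- implied.
  have hmin : 1 ≤ min p m := by
    have : (0 : ℝ) ≤ 2 * (((min p m : ℕ) : ℝ) - 1) := (mul_nonneg ht0 hd.le).trans ht'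
    have : (1 : ℝ) ≤ ((min p m : ℕ) : ℝ) := by linarith
    exact_mod_cast this
  obtain ⟨G, hGm, hGae, hGle⟩ := exists_measurable_ae_eq_shrinkGain (q := q) hSig ht0 hmin ht'
  set P := canonicalLaw m f θ Sig
  have hgram : ∀ u : Fin m → Fin p → ℝ, (gram u).PosSemidef := fun u =>
    posSemidef_transpose_mul_self (Matrix.of u)
  have hgramT : ∀ u : Fin m → Fin p → ℝ, (gram u).transpose = gram u := fun u => by
    simpa [Matrix.IsHermitian] using (hgram u).isHermitian
  have hGae' : ∀ᵐ x ∂P, 0 < (pinv (gram x.2)).trace ∧ shrinkGain t Sig (gram x.2) = G x.2 :=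
    (withDensity_absolutelyContinuous _ _).ae_le hGae
  have hG0 : ∀ᵐ x ∂P, 0 ≤ G x.2 := by
    filter_upwards [hGae'] with x hx
    rw [← hx.2]
    exact shrinkGain_nonneg ht0 hSig (hgram x.2)
  have hGP := lintegral_canonicalLaw_le hf θ hSig hGm.ennreal_ofReal (hGle f hf)
  have hGmeas : Measurable fun x : Obs q m p => G x.2 := hGm.comp measurable_snd
  have hGfin : ∫⁻ x, ENNReal.ofReal (G x.2) ∂P ≠ ∞ :=
    ne_top_of_le_ne_top (ENNReal.mul_ne_top ENNReal.ofReal_ne_top hK) hGP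
  have hGint : Integrable (fun x : Obs q m p => G x.2) P :=
    (lintegral_ofReal_ne_top_iff_integrable hGmeas.aestronglyMeasurable hG0).1 hGfin
  have hGbound : ∫ x, G x.2 ∂P ≤ 2 * t * (max p m : ℕ) * (kStar q m p f).toReal := by
    rw [integral_eq_lintegral_of_nonneg_ae hG0 hGmeas.aestronglyMeasurable]
    refine (ENNReal.toReal_mono (ENNReal.mul_ne_top ENNReal.ofReal_ne_top hK) hGP).trans_eq ?_
    rw [ENNReal.toReal_mul, ENNReal.toReal_ofReal (by positivity)]
  set a := aOpt q m p f with ha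
  have hdiff : (fun x : Obs q m p => dataLoss (gram x.2) Sig (konnoEst q m p f t x) -
      dataLoss (gram x.2) Sig (usualEst q m p f x)) =ᵐ[P] fun x => a ^ 2 * G x.2 - 2 * (a * t) := by
    filter_upwards [hGae'] with x hx
    have := dataLoss_sub_dataLoss hSig.det_pos.ne' (hgramT x.2) a (t / (pinv (gram x.2)).trace)
    rw [div_mul_cancel₀ _ hx.1.ne'] at this
    rw [← hx.2]
    exact this
  have hint : Integrable (fun x : Obs q m p => dataLoss (gram x.2) Sig (konnoEst q m p f t x) -
      dataLoss (gram x.2) Sig (usualEst q m p f x)) P :=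
    ((hGint.const_mul _).sub (integrable_const _)).congr hdiff.symm
  have hle : ∫ x, (dataLoss (gram x.2) Sig (konnoEst q m p f t x) -
      dataLoss (gram x.2) Sig (usualEst q m p f x)) ∂P ≤ 0 := by
    rw [integral_congr_ae hdiff, integral_sub (hGint.const_mul _) (integrable_const _),
      integral_const_mul, integral_const, probReal_univ, one_smul]
    -- The choice of a_o makes the quadratic and linear terms cancel exactly. If the denominator
    -- were 0 then a = 0 by convention and the identity still holds.
    have h1 : a ^ 2 * ((kStar q m p f).toReal * ((max p m : ℕ) : ℝ)) = a := by
      by_cases h0 : (kStar q m p f).toReal * ((max p m : ℕ) : ℝ) = 0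
      · rw [h0, mul_zero, ha, aOpt, h0, div_zero]
      · rw [ha, aOpt]; field_simp
    calc a ^ 2 * ∫ x, G x.2 ∂P - 2 * (a * t)
        ≤ a ^ 2 * (2 * t * (max p m : ℕ) * (kStar q m p f).toReal) - 2 * (a * t) := by gcongr
      _ = 2 * t * (a ^ 2 * ((kStar q m p f).toReal * ((max p m : ℕ) : ℝ))) - 2 * (a * t) := by ring
      _ = 0 := by rw [h1]; ring
  refine ⟨lintegral_ofReal_le_of_integral_sub_nonpos (fun x => ?_) (fun x => ?_) hint hle, hint, hle⟩
  · refine dataLoss_nonneg (hgram x.2) hSig ?_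
    rw [konnoEst, Matrix.transpose_smul, Matrix.transpose_add, Matrix.transpose_smul,
      (pinv_spec (gram x.2)).symm_left, hgramT]
  · refine dataLoss_nonneg (hgram x.2) hSig ?_
    rw [usualEst, Matrix.transpose_smul, hgramT]
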